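/- Let $\Pi=\{z\in\mathbb C:\operatorname{Im} z>0\}$ and let $\gamma:[0,\infty)\to[0,\infty)$ be monotone increasing with $\gamma(t)>0$ for $t>0$ and $\gamma(t)=O(t^2)$ as $t\to0^+$. Let $\tau\in\mathbb R$ and let $f:\Pi\to\overline{\Pi}$ be analytic. Definitions. The Julia quotient is $J_f(z)=\dfrac{\operatorname{dist}(f(z),\partial\Pi)}{\operatorname{dist}(z,\partial\Pi)}=\dfrac{\operatorname{Im}f(z)}{\operatorname{Im}z}$. The Nevanlinna measure $\mu_f$ is the locally finite Borel measure on $\mathbb R$ that is the weak (vague) limit of $\operatorname{Im}f(x+iy)\,dx$ as $y\to0^+$. The function $f$ is $\gamma$-regular at $\tau$ if there is $C>0$ such that $1/\gamma(C|t-\tau|)$ (with $1/0=\infty$) is $\mu_f$-integrable on a neighbourhood of $\tau$. For $\lambda:[0,\infty)\to[0,\infty)$, the $\lambda$-Stolz region at $\tau$ is $$S^\lambda_\tau=\{z\in\Pi:\ \operatorname{Im}z\ge\lambda(C)\text{ and }|\operatorname{Re}z-\tau|\le C\text{ for some }C>0\},$$ and for $d>0$ with $\lambda(d)>0$ the amortized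 Julia quotient $AJ^\tau_{f,\lambda}(d)$ is the average, with respect to arclength, of $J_f$ over the segment $\{z:\operatorname{Im}z=\lambda(d),\ |\operatorname{Re}z-\tau|\le d\}$; saying that it is bounded as $d\to0$ includes that $\lambda(d)>0$ for all small $d>0$. The function $\lambda$ is a $\gamma$-augury if $\lambda(t)=o(t)$ as $t\to0^+$ and, for some $C>0$, the expression $t\,\lambda(Ct)\,\dfrac{d\gamma(t)}{\gamma(t)^2}$ is integrable on $[0,1)$; here $d\gamma$ is the distributional derivative of $\gamma$ and $d\gamma/\gamma^2$ means the measure $-d(1/\gamma)=\dfrac{d\gamma(t)}{\gamma(t^-)\gamma(t^+)}$, which for continuous $\gamma$ is literally $\gamma(t)^{-2}\,d\gamma(t)$. Theorem. 1. $f$ is $\gamma$-regular at $\tau$ if and only if there is a $\gamma$-augury $\lambda$ such that $AJ^\tau_{f,\lambda}(d)$ is bounded as $d\to0$. 2. Suppose that $\sqrt{\gamma}$ is a $\gamma$-augury. Then the following are equivalent: (a) $f$ is $\gamma$-regular at $\tau$; (b) for some $C,D>0$, with $\lambda(t)=\sqrt{D\gamma(Ct)}$, $J_f(z)$ is bounded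 on $S^{\lambda}_\tau$ as $z\to\tau$; (c) for some $C,D>0$, $\displaystyle\limsup_{t\to0,\,t\ne0}J_f\big(\tau+t+iD\gamma(C|t|)\big)<\infty$. 3. Suppose that $t\mapsto\gamma(t)/t$ is a $\gamma$-augury. Then $f$ is $\gamma$-regular at $\tau$ if and only if, for some $C>0$, with $\lambda(t)=\gamma(Ct)/(Ct)$, $AJ^\tau_{f,\lambda}(d)$ is bounded as $d\to0$. -/

import Mathlib

open MeasureTheory Set Filter Topology Asymptotics
open scoped NNReal ENNReal

noncomputable section

namespace JuliaAugury

/-- The open upper half plane `Π`. -/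
def upperHalf : Set ℂ := {z : ℂ | 0 < z.im}

/-- The Julia quotient `dist (f z, ∂Ω) / dist (z, ∂D)` of `f : D → Ω`. -/
def juliaQuotient (D Ω : Set ℂ) (f : ℂ → ℂ) (z : ℂ) : ℝ :=
  Metric.infDist (f z) (frontier Ω) / Metric.infDist z (frontier D)

/-- `sqrt (dist (z, τ) ^ 2 - dist (z, ∂D) ^ 2)`; in the half plane with `τ` real it is
`|Re z - τ|`. -/
def tangentialDist (D : Set ℂ) (τ z : ℂ) : ℝ :=
  Real.sqrt (dist z τ ^ 2 - Metric.infDist z (frontier D) ^ 2)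

/-- The `lam`-Stolz region in `D` at `τ`. -/
def stolzRegion (D : Set ℂ) (lam : ℝ≥0 → ℝ≥0) (τ : ℂ) : Set ℂ :=
  {z ∈ D | ∃ C : ℝ≥0, 0 < C ∧ (lam C : ℝ) ≤ Metric.infDist z (frontier D) ∧
    tangentialDist D τ z ≤ C}

/-- The arc `C_d`: the points of `D` at distance `lam d` from `∂D` whose tangential distance
from `τ` is at most `d`. -/
def arc (D : Set ℂ) (lam : ℝ≥0 → ℝ≥0) (τ : ℂ) (d : ℝ≥0) : Set ℂ :=
  {z ∈ D | Metric.infDist z (frontier D) = lam d ∧ tangentialDist D τ z ≤ d}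

/-- The amortized Julia quotient: the average of the Julia quotient over `C_d` with respect to
arclength (one-dimensional Hausdorff measure). -/
def amortizedJulia (D Ω : Set ℂ) (f : ℂ → ℂ) (lam : ℝ≥0 → ℝ≥0) (τ : ℂ) (d : ℝ≥0) : ℝ :=
  ⨍ z in arc D lam τ d, juliaQuotient D Ω f z ∂(Measure.hausdorffMeasure 1)

/-- For a function `f` on the upper half plane, `AJ(d)` is bounded as `d → 0+`. For small `d > 0`
it is also required to be defined, i.e. `C_d` is an arc inside the open half plane, which means
`0 < lam d`. -/
def AmortizedJuliaBounded (f : ℂ → ℂ) (lam : ℝ≥0 → ℝ≥0) (τ : ℝ) : Prop :=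
  ∃ M : ℝ, ∀ᶠ d in 𝓝[>] (0 : ℝ≥0),
    0 < lam d ∧ amortizedJulia upperHalf upperHalf f lam (τ : ℂ) d ≤ M

/-- `μ` is the Nevanlinna measure of `f`: the locally finite Borel measure on the line which is
the weak (vague) limit of the measures `Im f (x + i y) dx` as `y → 0+`. Such a limit is unique. -/
def IsNevanlinnaMeasure (f : ℂ → ℂ) (μ : Measure ℝ) : Prop :=
  IsLocallyFiniteMeasure μ ∧
  ∀ φ : ℝ → ℝ, Continuous φ → HasCompactSupport φ →
    Tendsto (fun y : ℝ => ∫ x : ℝ, φ x * (f (x + y * Complex.I)).im) (𝓝[>] 0)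
      (𝓝 (∫ x, φ x ∂μ))

/-- `f` is `γ`-regular at `τ`: for some `C > 0`, `1 / γ (C |t - τ|)` (with `1 / 0 = ∞`) is
integrable near `τ` with respect to the Nevanlinna measure of `f`. -/
def IsRegularAt (γ : ℝ≥0 → ℝ≥0) (f : ℂ → ℂ) (τ : ℝ) : Prop :=
  ∃ μ : Measure ℝ, IsNevanlinnaMeasure f μ ∧
    ∃ C : ℝ≥0, 0 < C ∧ ∃ U ∈ 𝓝 τ,
      ∫⁻ t in U, ((γ (C * Real.nnabs (t - τ)) : ℝ≥0∞))⁻¹ ∂μ < ∞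

/-- The distributional derivative `dγ` of an increasing function on `[0, ∞)`, i.e. its
Lebesgue-Stieltjes measure. -/
def dMeasure {γ : ℝ≥0 → ℝ≥0} (hγ : Monotone γ) : Measure ℝ≥0 :=
  (Monotone.stieltjesFunction (f := fun t : ℝ≥0 => (γ t : ℝ)) (fun _ _ h => hγ h)).measure

/-- `lam` is a `γ`-augury: `lam t = o(t)` as `t → 0+`, and for some `C > 0` the expression
`t * lam (C t) * dγ(t) / γ(t) ^ 2` is integrable on `[0, 1)`. Here `dγ / γ ^ 2` is the measure
`-d(1/γ)`, whose density with respect to `dγ` is `1 / (γ(t-) γ(t+))`; this is `1 / γ(t) ^ 2`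
at every point of continuity of `γ`, so everywhere if `γ` is continuous. -/
def IsAugury {γ : ℝ≥0 → ℝ≥0} (hγ : Monotone γ) (lam : ℝ≥0 → ℝ≥0) : Prop :=
  (fun t : ℝ≥0 => (lam t : ℝ)) =o[𝓝[>] 0] (fun t : ℝ≥0 => (t : ℝ)) ∧
  ∃ C : ℝ≥0, 0 < C ∧
    IntegrableOn
      (fun t : ℝ≥0 =>
        ((t * lam (C * t) / (Function.leftLim γ t * Function.rightLim γ t) : ℝ≥0) : ℝ))
      (Ico 0 1) (dMeasure hγ)

end JuliaAugury

end

namespace JuliaAugury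

/-! ### Herglotz representation on the unit disc. -/

section Disc

open Metric Complex Real

/-! Everything is read off from the masses `m(d) = μ [τ - d, τ + d]` of the Nevanlinna measure. The
Herglotz representation, moved to the half plane, gives `Im f / Im z = A + ∫ π⁻¹ / ((x - t)² + y²)
dμ(t)` with `A` finite. Averaging this over the segment of height `λ(d) ≤ d` and half-width `d`
captures at least a fixed multiple of `m(d) / (d λ(d))`, because each `t` in the interval sees a
piece of length `λ(d)` close to it (`HasPoissonRepresentation.measure_le_of_amortizedJulia`). In the
other direction the average is at most a constant plus a multiple of `m(2d) / (d λ(d))`, provided `∫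
|t - τ|⁻² dμ < ∞` controls the far part (`HasPoissonRepresentation.amortizedJuliaBounded`);
regularity together with `γ(t) = O(t²)` supplies that integral. Thus boundedness of the amortized
quotient is tied to `m(d) ≲ d λ(d)`.

Integration by parts links these masses to regularity. By the fundamental theorem of calculus for
`1/γ` (`lintegral_invDensity_Ioc`) and Tonelli, integrability of `1/γ(C|t - τ|)` near `τ` amounts,
up to dilations, to finiteness of `∫ m(as) d(-1/γ)(s)`. If `m(d) ≤ K d λ(d)` for an augury `λ`, this
is the augury integral (`isRegularAt_of_measure_le`). Conversely, regularity makes `m(2d)/d`, plus a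
harmless positive term, an augury (`exists_isAugury_of_setLIntegral_lt_top`).

For the concrete auguries, Markov's inequality turns regularity into `m(d) ≤ I γ(cd)`. This fits
`λ(t) = γ(ct)/(ct)` exactly. It also bounds `J_f` pointwise wherever `γ(cd) ≤ K y²`, hence on the
Stolz region of `√γ`. On the curve of height `γ` one further needs `γ(as) ≤ K γ(s)²`, which is
forced by `√γ` being an augury (`exists_comp_mul_le_sq_of_isAugury_sqrt`). The returns from the
Stolz region and from the curve go through the amortized quotient, the curve using that `J_f`
decreases along vertical lines. -/

theorem continuous_poissonKernel_sphere {w : ℂ} (hw : w ∈ ball (0 : ℂ) 1) :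
    Continuous fun ζ : sphere (0 : ℂ) 1 => poissonKernel 0 w (ζ : ℂ) := by
  unfold poissonKernel
  apply Continuous.div (by fun_prop) (by fun_prop)
  intro ζ
  have h1 : ‖(ζ : ℂ)‖ = 1 := by simp
  have h2 : ‖w‖ < 1 := by simpa using hw
  have : (ζ : ℂ) - 0 - (w - 0) ≠ 0 := by
    intro h0
    have : (ζ : ℂ) = w := by simpa [sub_eq_zero] using h0
    rw [this] at h1; linarith
  exact pow_ne_zero _ (norm_ne_zero_iff.2 this)

/-- With boundary values available this is the Poisson formula, the measure being `(2π)⁻¹ Re h dθ`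
carried to the circle. -/
theorem exists_finiteMeasure_poissonKernel_of_diffContOnCl {h : ℂ → ℂ}
    (hd : DiffContOnCl ℂ h (ball 0 1)) (hpos : ∀ w ∈ closedBall (0 : ℂ) 1, 0 ≤ (h w).re) :
    ∃ ν : FiniteMeasure (sphere (0 : ℂ) 1), ∀ w ∈ ball (0 : ℂ) 1,
      (h w).re = ∫ ζ : sphere (0 : ℂ) 1, poissonKernel 0 w (ζ : ℂ) ∂ν := by
  set e : ℝ → sphere (0 : ℂ) 1 := fun θ => ⟨circleMap 0 1 θ, circleMap_mem_sphere 0 zero_le_one θ⟩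
    with he
  have hec : Continuous e := by
    rw [he]; exact Continuous.subtype_mk (continuous_circleMap 0 1) _
  have hcont' : Continuous fun θ : ℝ => h (circleMap 0 1 θ) := by
    have h1 : ContinuousOn h (closedBall 0 1) := by
      have := hd.continuousOn
      rwa [closure_ball _ one_ne_zero] at this
    exact h1.comp_continuous (continuous_circleMap 0 1)
        fun θ => sphere_subset_closedBall (circleMap_mem_sphere 0 zero_le_one θ)
  have hcont : Continuous fun θ : ℝ => (h (circleMap 0 1 θ)).re :=
    Complex.continuous_re.comp hcont'
  have hnn : ∀ θ : ℝ, 0 ≤ (h (circleMap 0 1 θ)).re := fun θ =>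
    hpos _ (sphere_subset_closedBall (circleMap_mem_sphere 0 zero_le_one θ))
  set D : ℝ → ℝ≥0 := fun θ => Real.toNNReal ((2 * π)⁻¹ * (h (circleMap 0 1 θ)).re) with hD
  have hDc : Continuous D := by rw [hD]; fun_prop
  set ρ : Measure ℝ := (volume.restrict (Ioc 0 (2 * π))).withDensity fun θ => (D θ : ℝ≥0∞) with hρ
  have hfin : IsFiniteMeasure ρ := by
    apply isFiniteMeasure_withDensity
    have : IntegrableOn (fun θ => (D θ : ℝ)) (Ioc 0 (2 * π)) := by
      apply Continuous.integrableOn_Ioc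
      fun_prop
    have h3 := this.lintegral_lt_top
    simpa using h3.ne
  refine ⟨⟨ρ.map e, inferInstance⟩, fun w hw => ?_⟩
  have key := hd.circleAverage_poissonKernel_smul hw
  have hP := continuous_poissonKernel_sphere hw
  rw [FiniteMeasure.toMeasure_mk, integral_map hec.aemeasurable hP.aestronglyMeasurable, hρ,
    integral_withDensity_eq_integral_smul hDc.measurable, ← key, Real.circleAverage_def,
    intervalIntegral.integral_of_le (by positivity), ← integral_smul,
    ← Complex.reCLM_apply, ← ContinuousLinearMap.integral_comp_comm]
  · apply integral_congr_ae
    filter_upwards with θ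
    have : (D θ : ℝ) = (2 * π)⁻¹ * (h (circleMap 0 1 θ)).re := by
      rw [hD]; apply Real.coe_toNNReal
      have := hnn θ
      positivity
    simp [NNReal.smul_def, this, he]
    ring
  · have h1 : Continuous fun θ : ℝ => poissonKernel 0 w (e θ : ℂ) := hP.comp hec
    have h2 : Continuous fun θ : ℝ =>
        (2 * π)⁻¹ • (poissonKernel 0 w (e θ : ℂ) • h (circleMap 0 1 θ)) :=
      (h1.smul hcont').const_smul (2 * π)⁻¹
    exact h2.integrableOn_Ioc

/-- **Herglotz representation** of holomorphic functions with nonnegative real part on the unit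
disc. -/
theorem exists_finiteMeasure_poissonKernel {h : ℂ → ℂ}
    (hd : DifferentiableOn ℂ h (ball 0 1)) (hpos : ∀ w ∈ ball (0 : ℂ) 1, 0 ≤ (h w).re) :
    ∃ ν : FiniteMeasure (sphere (0 : ℂ) 1), ∀ w ∈ ball (0 : ℂ) 1,
      (h w).re = ∫ ζ : sphere (0 : ℂ) 1, poissonKernel 0 w (ζ : ℂ) ∂ν := by
  have hball : ∀ r ∈ Ioo (0 : ℝ) 1, ∀ w ∈ closedBall (0 : ℂ) 1, (r : ℂ) * w ∈ ball (0 : ℂ) 1 := by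
    intro r hr w hw
    simp only [mem_closedBall, dist_zero_right, mem_ball, norm_mul, Complex.norm_real,
      Real.norm_eq_abs, abs_of_pos hr.1] at hw ⊢
    nlinarith [hr.1, hr.2, norm_nonneg w]
  -- The dilates `w ↦ h (r w)` extend to the closed disc. The condition on `r` stands inside the
  -- existential so that `choose` yields a total function of `r`.
  have hN : ∀ r : ℝ, ∃ ν : FiniteMeasure (sphere (0 : ℂ) 1), r ∈ Ioo (0 : ℝ) 1 →
      ∀ w ∈ ball (0 : ℂ) 1,
        (h (r * w)).re = ∫ ζ : sphere (0 : ℂ) 1, poissonKernel 0 w (ζ : ℂ) ∂ν := by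
    intro r
    by_cases hr : r ∈ Ioo (0 : ℝ) 1
    · have h1 : DifferentiableOn ℂ (fun w => h (r * w)) (closedBall 0 1) :=
        hd.comp (by fun_prop) (hball r hr)
      have h2 : DiffContOnCl ℂ (fun w => h (r * w)) (ball 0 1) := by
        apply DifferentiableOn.diffContOnCl
        rwa [closure_ball _ one_ne_zero]
      obtain ⟨ν, hν⟩ := exists_finiteMeasure_poissonKernel_of_diffContOnCl h2
        fun w hw => hpos _ (hball r hr w hw)
      exact ⟨ν, fun _ => hν⟩
    · exact ⟨0, fun h => absurd h hr⟩
  choose N hN using hN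
  -- All the measures have mass `Re h(0)`, the kernel at the centre being `1`. Compactness then
  -- gives a limit along any ultrafilter finer than `r → 1⁻`.
  set U : Ultrafilter ℝ := Ultrafilter.of (𝓝[<] (1 : ℝ)) with hU
  have hU1 : (U : Filter ℝ) ≤ 𝓝[<] (1 : ℝ) := Ultrafilter.of_le _
  have hev : ∀ᶠ r in (U : Filter ℝ), r ∈ Ioo (0 : ℝ) 1 :=
    hU1 (Ioo_mem_nhdsLT zero_lt_one)
  have h0 : (0 : ℂ) ∈ ball (0 : ℂ) 1 := by simp
  have hmass : ∀ᶠ r in (U : Filter ℝ),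
      N r ∈ {ν : FiniteMeasure (sphere (0 : ℂ) 1) | ν.mass ≤ Real.toNNReal (h 0).re} := by
    filter_upwards [hev] with r hr
    have := hN r hr 0 h0
    have h3 : ∀ ζ : sphere (0 : ℂ) 1, poissonKernel 0 0 (ζ : ℂ) = 1 := by
      intro ζ; simp [poissonKernel]
    simp only [mul_zero, h3, integral_const, smul_eq_mul, mul_one] at this
    change (N r).mass ≤ _
    rw [this]
    apply le_of_eq
    exact (Real.toNNReal_coe (r := (N r).mass)).symm
  obtain ⟨ν, -, hν⟩ := (isCompact_setOfPred_finiteMeasure_le_of_compactSpace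
    (sphere (0 : ℂ) 1) (Real.toNNReal (h 0).re)).ultrafilter_le_nhds (U.map N)
      (Filter.le_principal_iff.2 hmass)
  have hνt : Tendsto N U (𝓝 ν) := hν
  refine ⟨ν, fun w hw => ?_⟩
  have t1 := (FiniteMeasure.tendsto_iff_forall_integral_tendsto.1 hνt)
    (BoundedContinuousFunction.mkOfCompact ⟨_, continuous_poissonKernel_sphere hw⟩)
  simp only [BoundedContinuousFunction.mkOfCompact_apply, ContinuousMap.coe_mk] at t1
  have t2 : Tendsto (fun r : ℝ => (h (r * w)).re) (𝓝[<] (1 : ℝ)) (𝓝 (h w).re) := by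
    have c1 : ContinuousAt h (((1 : ℝ) : ℂ) * w) := by
      simpa using (hd.differentiableAt (isOpen_ball.mem_nhds hw)).continuousAt
    have c2 : ContinuousAt (fun r : ℝ => (h (r * w)).re) 1 :=
      Complex.continuous_re.continuousAt.comp
        (ContinuousAt.comp (f := fun r : ℝ => (r : ℂ) * w) (x := (1 : ℝ)) c1 (by fun_prop))
    simpa using c2.tendsto.mono_left nhdsWithin_le_nhds
  refine tendsto_nhds_unique (t2.mono_left hU1) (t1.congr' ?_)
  filter_upwards [hev] with r hr using (hN r hr w hw).symm

end Disc

/-! ### Poisson representation in the half plane via the Cayley transform. -/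

section HalfPlane

open Metric Complex Real

/-- The Poisson kernel of the upper half plane, divided by the distance to the boundary. -/
noncomputable def poissonQuotient (x y t : ℝ) : ℝ := π⁻¹ * ((x - t) ^ 2 + y ^ 2)⁻¹

theorem measurable_poissonQuotient (x y : ℝ) : Measurable (poissonQuotient x y) := by
  unfold poissonQuotient; fun_prop

theorem poissonQuotient_nonneg (x y t : ℝ) : 0 ≤ poissonQuotient x y t := by
  unfold poissonQuotient; positivity

/-- `Im f / Im z` is the sum of a constant and a Poisson integral. -/
def HasPoissonRepresentation (f : ℂ → ℂ) (A : ℝ≥0∞) (μ : Measure ℝ) : Prop :=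
  ∀ x y : ℝ, 0 < y → ENNReal.ofReal ((f (x + y * I)).im / y) =
    A + ∫⁻ t, ENNReal.ofReal (poissonQuotient x y t) ∂μ

theorem cayley_mem_ball {x y : ℝ} (hy : 0 < y) :
    ((x + y * I) - I) / ((x + y * I) + I) ∈ ball (0 : ℂ) 1 := by
  have h1 : ((x : ℂ) + y * I) - I = x + (y - 1 : ℝ) * I := by push_cast; ring
  have h2 : ((x : ℂ) + y * I) + I = x + (y + 1 : ℝ) * I := by push_cast; ring
  have h3 : 0 < ‖(x : ℂ) + (y + 1 : ℝ) * I‖ := by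
    rw [norm_add_mul_I]; positivity
  rw [mem_ball_zero_iff, h1, h2, norm_div, div_lt_one h3, norm_add_mul_I, norm_add_mul_I]
  apply Real.sqrt_lt_sqrt (by positivity)
  nlinarith

theorem poissonKernel_cayley {x y t : ℝ} (hy : 0 < y) :
    poissonKernel 0 (((x + y * I) - I) / ((x + y * I) + I)) ((t - I) / (t + I)) =
      y * (π * (1 + t ^ 2) * poissonQuotient x y t) := by
  have h1 : ((x : ℂ) + y * I) - I = x + (y - 1 : ℝ) * I := by push_cast; ring
  have h2 : ((x : ℂ) + y * I) + I = x + (y + 1 : ℝ) * I := by push_cast; ring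
  have e1 : (t : ℂ) - I = t + (-1 : ℝ) * I := by push_cast; ring
  have e2 : (t : ℂ) + I = t + (1 : ℝ) * I := by push_cast; ring
  have n2 : (x : ℂ) + (y + 1 : ℝ) * I ≠ 0 := by
    intro h
    have := congrArg Complex.im h
    simp at this; linarith
  have n4 : (t : ℂ) + (1 : ℝ) * I ≠ 0 := by
    intro h
    have := congrArg Complex.im h
    simp at this
  have e3 : ((t : ℂ) + (-1 : ℝ) * I) / (t + (1 : ℝ) * I) -
      (x + (y - 1 : ℝ) * I) / (x + (y + 1 : ℝ) * I) =
        (2 * I * ((t - x : ℝ) + (-y : ℝ) * I)) / ((t + (1 : ℝ) * I) * (x + (y + 1 : ℝ) * I)) := by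
    rw [div_sub_div _ _ n4 n2]
    congr 1
    push_cast
    linear_combination (0 : ℂ) * Complex.I_sq
  have sqn : ∀ a b : ℝ, ‖(a : ℂ) + b * I‖ ^ 2 = a ^ 2 + b ^ 2 := by
    intro a b
    rw [norm_add_mul_I, Real.sq_sqrt (by positivity)]
  rw [poissonKernel, h1, h2, e1, e2, sub_zero, sub_zero, e3]
  simp only [norm_div, norm_mul, div_pow, mul_pow, sqn, Complex.norm_I, Complex.norm_ofNat]
  have p1 : t ^ 2 + 1 ^ 2 ≠ 0 := by positivity
  have p2 : x ^ 2 + (y + 1) ^ 2 ≠ 0 := by positivity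
  have p3 : (t - x) ^ 2 + (-y) ^ 2 ≠ 0 := by rw [neg_sq]; positivity
  have p4 : (x - t) ^ 2 + y ^ 2 ≠ 0 := by positivity
  have p5 : (1 + t ^ 2) ≠ 0 := by positivity
  rw [poissonQuotient]
  field_simp
  ring

theorem exists_eq_cayley {ζ : ℂ} (hζ : ‖ζ‖ = 1) (h1 : ζ ≠ 1) :
    ζ = (((I * (1 + ζ) / (1 - ζ)).re : ℝ) - I) / (((I * (1 + ζ) / (1 - ζ)).re : ℝ) + I) := by
  have h2 : (1 - ζ) ≠ 0 := sub_ne_zero.2 h1.symm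
  have h3 : (I * (1 + ζ) / (1 - ζ)).im = 0 := by
    have hz : ζ.re ^ 2 + ζ.im ^ 2 = 1 := by
      have := Complex.sq_norm ζ
      rw [hζ, Complex.normSq_apply] at this
      linarith
    rw [Complex.div_im]
    have : Complex.normSq (1 - ζ) ≠ 0 := by simpa [Complex.normSq_eq_zero] using h2
    field_simp
    simp
    nlinarith
  have h4 : ((I * (1 + ζ) / (1 - ζ)).re : ℂ) = I * (1 + ζ) / (1 - ζ) := by
    apply Complex.ext <;> simp [h3]
  rw [h4]
  have h5 : I * (1 + ζ) / (1 - ζ) + I = 2 * I / (1 - ζ) := by field_simp; ring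
  have h6 : I * (1 + ζ) / (1 - ζ) - I = 2 * I * ζ / (1 - ζ) := by field_simp; ring
  rw [h5, h6]
  field_simp

/-- The boundary point `1` corresponds to infinity; an atom of the circle measure there contributes
the linear term of `Im f`, that is, the constant `A`. -/
theorem poissonKernel_cayley_one {x y : ℝ} (hy : 0 < y) :
    poissonKernel 0 (((x + y * I) - I) / ((x + y * I) + I)) 1 = y := by
  have h1 : ((x : ℂ) + y * I) - I = x + (y - 1 : ℝ) * I := by push_cast; ring
  have h2 : ((x : ℂ) + y * I) + I = x + (y + 1 : ℝ) * I := by push_cast; ring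
  have n2 : (x : ℂ) + (y + 1 : ℝ) * I ≠ 0 := by
    intro h
    have := congrArg Complex.im h
    simp at this; linarith
  have e3 : 1 - (x + (y - 1 : ℝ) * I) / (x + (y + 1 : ℝ) * I) =
        2 * I / (x + (y + 1 : ℝ) * I) := by
    rw [eq_div_iff n2, sub_mul, div_mul_cancel₀ _ n2]
    push_cast
    ring
  have sqn : ∀ a b : ℝ, ‖(a : ℂ) + b * I‖ ^ 2 = a ^ 2 + b ^ 2 := by
    intro a b
    rw [norm_add_mul_I, Real.sq_sqrt (by positivity)]
  rw [poissonKernel, h1, h2, sub_zero, sub_zero, e3]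
  simp only [norm_div, norm_mul, div_pow, mul_pow, sqn, Complex.norm_I, Complex.norm_ofNat]
  have p2 : x ^ 2 + (y + 1) ^ 2 ≠ 0 := by positivity
  simp only [norm_one]
  field_simp
  ring

theorem exists_hasPoissonRepresentation {f : ℂ → ℂ} (hf : DifferentiableOn ℂ f upperHalf)
    (hmaps : MapsTo f upperHalf (closure upperHalf)) :
    ∃ A : ℝ≥0∞, A ≠ ∞ ∧ ∃ μ, HasPoissonRepresentation f A μ := by
  have him : ∀ z ∈ upperHalf, 0 ≤ (f z).im := by
    intro z hz
    have := hmaps hz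
    rwa [upperHalf, Complex.closure_setOfPred_lt_im] at this
  have hcay : ∀ w ∈ ball (0 : ℂ) 1, I * (1 + w) / (1 - w) ∈ upperHalf := by
    intro w hw
    have hw1 : w.re ^ 2 + w.im ^ 2 < 1 := by
      have h1 : ‖w‖ < 1 := by simpa using hw
      have := Complex.sq_norm w
      rw [Complex.normSq_apply] at this
      nlinarith [norm_nonneg w]
    have h2 : 1 - w ≠ 0 := by
      intro h
      have h3 : w = 1 := by linear_combination -h
      rw [h3] at hw1
      simp at hw1
    have h4 : 0 < Complex.normSq (1 - w) := Complex.normSq_pos.2 h2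
    change 0 < (I * (1 + w) / (1 - w)).im
    rw [Complex.div_im, ← sub_div]
    apply div_pos _ h4
    simp
    nlinarith
  have hne : ∀ w ∈ ball (0 : ℂ) 1, 1 - w ≠ 0 := by
    intro w hw h
    have h3 : w = 1 := by linear_combination -h
    rw [h3] at hw
    simp at hw
  obtain ⟨ν, hν⟩ := exists_finiteMeasure_poissonKernel (h := fun w => -I * f (I * (1 + w) / (1 - w)))
    (by
      apply DifferentiableOn.const_mul
      apply hf.comp _ hcay
      apply DifferentiableOn.div (by fun_prop) (by fun_prop) hne)
    (by
      intro w hw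
      simpa using him _ (hcay w hw))
  set T : sphere (0 : ℂ) 1 → ℝ := fun ζ => (I * (1 + (ζ : ℂ)) / (1 - ζ)).re with hT
  have hTm : Measurable T := by
    apply Complex.measurable_re.comp
    fun_prop
  set ζ₁ : sphere (0 : ℂ) 1 := ⟨1, by simp⟩ with hζ₁
  -- The atom at `1` is split off as `A`; the rest moves to the line, and the density `π (1 + t²)`
  -- is the factor relating the two kernels in `poissonKernel_cayley`.
  refine ⟨(ν : Measure (sphere (0 : ℂ) 1)) {ζ₁}, measure_ne_top _ _,
    (((ν : Measure (sphere (0 : ℂ) 1)).restrict {ζ₁}ᶜ).map T).withDensity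
      fun t => ENNReal.ofReal (π * (1 + t ^ 2)), fun x y hy => ?_⟩
  set w : ℂ := ((x + y * I) - I) / ((x + y * I) + I) with hw
  have hwb : w ∈ ball (0 : ℂ) 1 := cayley_mem_ball hy
  have hz : I * (1 + w) / (1 - w) = x + y * I := by
    have n2 : (x : ℂ) + y * I + I ≠ 0 := by
      intro h
      have := congrArg Complex.im h
      simp at this; linarith
    rw [div_eq_iff (hne w hwb), hw]
    generalize (x : ℂ) + y * I = z at n2
    field_simp
    ring
  have hrep := hν w hwb
  rw [hz] at hrep
  have hP := continuous_poissonKernel_sphere hwb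
  have hPn : ∀ ζ : sphere (0 : ℂ) 1, 0 ≤ poissonKernel 0 w (ζ : ℂ) := by
    intro ζ
    have h1 : ‖w‖ < 1 := by simpa using hwb
    have h2 : ‖(ζ : ℂ)‖ = 1 := by simp
    rw [poissonKernel, sub_zero, sub_zero, h2]
    apply div_nonneg _ (by positivity)
    nlinarith [norm_nonneg w]
  have hint : Integrable (fun ζ : sphere (0 : ℂ) 1 => poissonKernel 0 w (ζ : ℂ))
      (ν : Measure (sphere (0 : ℂ) 1)) :=
    (BoundedContinuousFunction.mkOfCompact ⟨_, hP⟩).integrable _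
  have hrep2 : ENNReal.ofReal ((f (x + y * I)).im) =
      ∫⁻ ζ : sphere (0 : ℂ) 1, ENNReal.ofReal (poissonKernel 0 w (ζ : ℂ)) ∂ν := by
    rw [← ofReal_integral_eq_lintegral_ofReal hint (ae_of_all _ hPn), ← hrep]
    simp
  have hmeas : Measurable fun t => ENNReal.ofReal (poissonQuotient x y t) :=
    (measurable_poissonQuotient x y).ennreal_ofReal
  have hmeas2 : Measurable fun t : ℝ => ENNReal.ofReal (π * (1 + t ^ 2)) := by fun_prop
  have hkey : ∀ ζ ∈ ({ζ₁}ᶜ : Set (sphere (0 : ℂ) 1)), ENNReal.ofReal (poissonKernel 0 w (ζ : ℂ)) =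
      ENNReal.ofReal y * (ENNReal.ofReal (π * (1 + T ζ ^ 2)) *
        ENNReal.ofReal (poissonQuotient x y (T ζ))) := by
    intro ζ hζ
    have h1 : (ζ : ℂ) ≠ 1 := fun h => hζ (Subtype.ext h)
    have h2 := exists_eq_cayley (by simp) h1
    rw [← ENNReal.ofReal_mul (by positivity), ← ENNReal.ofReal_mul hy.le]
    congr 1
    conv_lhs => rw [h2]
    exact poissonKernel_cayley hy
  rw [ENNReal.ofReal_div_of_pos hy, hrep2]
  symm
  rw [ENNReal.eq_div_iff (by simpa using hy) ENNReal.ofReal_ne_top]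
  symm
  rw [← lintegral_add_compl _ (measurableSet_singleton ζ₁), setLIntegral_congr_fun
      (measurableSet_singleton ζ₁).compl hkey, lintegral_const_mul' _ _ ENNReal.ofReal_ne_top,
    lintegral_withDensity_eq_lintegral_mul _ hmeas2 hmeas,
    lintegral_map (hmeas2.mul hmeas) hTm, lintegral_singleton, mul_add]
  congr 1
  rw [hζ₁, poissonKernel_cayley_one hy]

end HalfPlane

/-! ### The representing measure is the Nevanlinna measure. -/

section Vague

open Real

theorem lintegral_poissonQuotient {y : ℝ} (hy : 0 < y) (t : ℝ) :
    ∫⁻ x, ENNReal.ofReal (poissonQuotient x y t) = ENNReal.ofReal y⁻¹ := by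
  have h := ProbabilityTheory.lintegral_cauchyPDF_eq_one t (γ := y.toNNReal)
    (by simpa using hy)
  have h2 : ∀ x, ENNReal.ofReal (poissonQuotient x y t) =
      ENNReal.ofReal y⁻¹ * ProbabilityTheory.cauchyPDF t y.toNNReal x := by
    intro x
    rw [ProbabilityTheory.cauchyPDF_def, ← ENNReal.ofReal_mul (by positivity),
      ProbabilityTheory.cauchyPDFReal_def, poissonQuotient]
    congr 1
    rw [Real.coe_toNNReal _ hy.le]
    field_simp
  simp_rw [h2]
  rw [lintegral_const_mul' _ _ ENNReal.ofReal_ne_top, h, mul_one]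

theorem measurable_poissonQuotient_uncurry (y : ℝ) :
    Measurable (Function.uncurry fun x t => poissonQuotient x y t) := by
  unfold poissonQuotient; fun_prop

/-- The representation is evaluated at `z = i`, where the left side is finite. -/
theorem lintegral_inv_one_add_sq_lt_top {f : ℂ → ℂ} {A : ℝ≥0∞} {μ : Measure ℝ}
    (h : HasPoissonRepresentation f A μ) :
    ∫⁻ t, ENNReal.ofReal (1 + t ^ 2)⁻¹ ∂μ < ∞ := by
  have h1 := h 0 1 one_pos
  have h2 : ∫⁻ t, ENNReal.ofReal (poissonQuotient 0 1 t) ∂μ < ∞ :=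
    lt_of_le_of_lt (le_add_self.trans h1.ge) ENNReal.ofReal_lt_top
  have h3 : ∀ t, ENNReal.ofReal (1 + t ^ 2)⁻¹ =
      ENNReal.ofReal π * ENNReal.ofReal (poissonQuotient 0 1 t) := by
    intro t
    rw [← ENNReal.ofReal_mul pi_pos.le, poissonQuotient]
    congr 1
    have : 1 + t ^ 2 ≠ 0 := by positivity
    have : (0 - t) ^ 2 + 1 ^ 2 ≠ 0 := by positivity
    field_simp
    ring
  simp_rw [h3]
  rw [lintegral_const_mul' _ _ ENNReal.ofReal_ne_top]
  exact ENNReal.mul_lt_top ENNReal.ofReal_lt_top h2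

theorem isLocallyFiniteMeasure_of_lintegral_inv_one_add_sq {μ : Measure ℝ}
    (h : ∫⁻ t, ENNReal.ofReal (1 + t ^ 2)⁻¹ ∂μ < ∞) : IsLocallyFiniteMeasure μ := by
  refine ⟨fun t => ⟨Metric.ball 0 (|t| + 1), Metric.isOpen_ball.mem_nhds (by simp), ?_⟩⟩
  set R := |t| + 1
  have hR : 0 < R := by positivity
  have h1 : ENNReal.ofReal (1 + R ^ 2)⁻¹ * μ (Metric.ball 0 R) ≤
      ∫⁻ t, ENNReal.ofReal (1 + t ^ 2)⁻¹ ∂μ := by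
    rw [← setLIntegral_const]
    refine le_trans (setLIntegral_mono' measurableSet_ball fun s hs => ?_)
      (setLIntegral_le_lintegral _ _)
    apply ENNReal.ofReal_le_ofReal
    have hs' : |s| < R := by simpa using hs
    have : s ^ 2 ≤ R ^ 2 := sq_le_sq' (by linarith [neg_abs_le s]) (by linarith [le_abs_self s])
    gcongr
  by_contra hcon
  rw [not_lt, top_le_iff] at hcon
  rw [hcon, ENNReal.mul_top (by simp; positivity)] at h1
  exact absurd h (not_lt.2 h1)

/-- The Poisson kernel is an approximate identity: the substitution `x = t + y s` puts `y` inside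
`φ` only, and dominated convergence applies. -/
theorem tendsto_integral_mul_poissonQuotient {φ : ℝ → ℝ} (hc : Continuous φ)
    (hs : HasCompactSupport φ) (t : ℝ) :
    Tendsto (fun y : ℝ => ∫ x, φ x * (y * poissonQuotient x y t)) (𝓝[>] 0) (𝓝 (φ t)) := by
  obtain ⟨K, hK⟩ := hc.bounded_above_of_compact_support hs
  have h1 : ∀ y : ℝ, 0 < y → ∫ x, φ x * (y * poissonQuotient x y t) =
      ∫ s, φ (t + y * s) * (π⁻¹ * (1 + s ^ 2)⁻¹) := by
    intro y hy
    rw [← integral_add_left_eq_self (fun x => φ x * (y * poissonQuotient x y t)) t]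
    have h2 := Measure.integral_comp_mul_left
      (fun x => φ (t + x) * (y * poissonQuotient (t + x) y t)) y
    rw [abs_of_pos (inv_pos.2 hy), smul_eq_mul, eq_comm, inv_mul_eq_iff_eq_mul₀ hy.ne'] at h2
    rw [h2, ← integral_const_mul]
    apply integral_congr_ae
    filter_upwards with s
    rw [poissonQuotient]
    have : 1 + s ^ 2 ≠ 0 := by positivity
    have : (t + y * s - t) ^ 2 + y ^ 2 ≠ 0 := by positivity
    field_simp
    ring
  have h3 : ∫ s : ℝ, φ t * (π⁻¹ * (1 + s ^ 2)⁻¹) = φ t := by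
    rw [integral_const_mul, integral_const_mul, integral_univ_inv_one_add_sq]
    field_simp
  have h4 : Tendsto (fun y : ℝ => ∫ s, φ (t + y * s) * (π⁻¹ * (1 + s ^ 2)⁻¹)) (𝓝[>] 0)
      (𝓝 (∫ s : ℝ, φ t * (π⁻¹ * (1 + s ^ 2)⁻¹))) := by
    apply tendsto_integral_filter_of_dominated_convergence
      (fun s : ℝ => K * (π⁻¹ * (1 + s ^ 2)⁻¹))
    · filter_upwards with y
      apply Continuous.aestronglyMeasurable
      have : ∀ s : ℝ, 1 + s ^ 2 ≠ 0 := fun s => by positivity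
      fun_prop (disch := assumption)
    · filter_upwards with y
      filter_upwards with s
      rw [norm_mul, Real.norm_of_nonneg (r := π⁻¹ * (1 + s ^ 2)⁻¹) (by positivity)]
      have := hK (t + y * s)
      gcongr
    · exact (integrable_inv_one_add_sq.const_mul _).const_mul _
    · filter_upwards with s
      apply Tendsto.mul_const
      have : ContinuousAt (fun y : ℝ => φ (t + y * s)) 0 := by fun_prop
      simpa using this.tendsto.mono_left nhdsWithin_le_nhds
  rw [h3] at h4
  refine h4.congr' ?_
  filter_upwards [self_mem_nhdsWithin] with y hy using (h1 y hy).symm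

/-- A majorant uniform in `y ∈ (0, 1]` and integrable for `μ`, needed to pass to the limit under `∫
dμ`. -/
theorem exists_forall_lintegral_mul_poissonQuotient_le {φ : ℝ → ℝ} (hc : Continuous φ)
    (hs : HasCompactSupport φ) :
    ∃ K : ℝ, ∀ y : ℝ, 0 < y → y ≤ 1 → ∀ t : ℝ,
      ∫⁻ x, ENNReal.ofReal (φ x) * ENNReal.ofReal (y * poissonQuotient x y t) ≤
        ENNReal.ofReal K * ENNReal.ofReal (1 + t ^ 2)⁻¹ := by
  obtain ⟨K₀, hK₀⟩ := hc.bounded_above_of_compact_support hs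
  have hK : 0 ≤ K₀ := (norm_nonneg _).trans (hK₀ 0)
  obtain ⟨R, hR, hsupp⟩ := hs.isCompact.isBounded.subset_closedBall_lt 0 0
  have hout : ∀ x : ℝ, R < |x| → φ x = 0 := by
    intro x hx
    apply image_eq_zero_of_notMem_tsupport
    intro h
    have := hsupp h
    simp at this
    linarith
  -- The first summand serves `|t| ≤ 2R`, where the unit mass of the kernel suffices. The second
  -- serves `|t| > 2R`, where `|x - t| ≥ |t|/2` on the support of `φ`.
  refine ⟨K₀ * (1 + 4 * R ^ 2) + K₀ * (2 * R) * (4 * π⁻¹) * (1 + R⁻¹ ^ 2), fun y hy hy1 t => ?_⟩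
  rw [← ENNReal.ofReal_mul (by positivity)]
  by_cases ht : |t| ≤ 2 * R
  · calc ∫⁻ x, ENNReal.ofReal (φ x) * ENNReal.ofReal (y * poissonQuotient x y t)
        ≤ ∫⁻ x, ENNReal.ofReal (K₀ * y) * ENNReal.ofReal (poissonQuotient x y t) := by
          apply lintegral_mono
          intro x
          beta_reduce
          rw [← ENNReal.ofReal_mul' (mul_nonneg hy.le (poissonQuotient_nonneg x y t)),
            ← ENNReal.ofReal_mul' (poissonQuotient_nonneg x y t)]
          apply ENNReal.ofReal_le_ofReal
          rw [mul_assoc]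
          have := (le_abs_self _).trans (hK₀ x)
          have := poissonQuotient_nonneg x y t
          gcongr
      _ = ENNReal.ofReal K₀ := by
          rw [lintegral_const_mul' _ _ ENNReal.ofReal_ne_top, lintegral_poissonQuotient hy,
            ← ENNReal.ofReal_mul (by positivity)]
          congr 1
          field_simp
      _ ≤ _ := by
          apply ENNReal.ofReal_le_ofReal
          have h1 : t ^ 2 ≤ 4 * R ^ 2 := by
            have := sq_le_sq' (by linarith [neg_abs_le t]) ((le_abs_self t).trans ht)
            linarith
          rw [← div_eq_mul_inv, le_div_iff₀ (by positivity)]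
          have : 0 ≤ K₀ * (2 * R) * (4 * π⁻¹) * (1 + R⁻¹ ^ 2) := by positivity
          nlinarith
  · rw [not_le] at ht
    have ht0 : 0 < |t| := by linarith
    have hts : 0 < t ^ 2 := by rw [← sq_abs]; positivity
    calc ∫⁻ x, ENNReal.ofReal (φ x) * ENNReal.ofReal (y * poissonQuotient x y t)
        ≤ ∫⁻ x, (Icc (-R) R).indicator (fun _ => ENNReal.ofReal (K₀ * (4 * π⁻¹ / t ^ 2))) x := by
          apply lintegral_mono
          intro x
          beta_reduce
          by_cases hx : x ∈ Icc (-R) R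
          · rw [indicator_of_mem hx, ← ENNReal.ofReal_mul'
              (mul_nonneg hy.le (poissonQuotient_nonneg x y t))]
            apply ENNReal.ofReal_le_ofReal
            have h1 := (le_abs_self _).trans (hK₀ x)
            have hxR : |x| ≤ R := abs_le.2 hx
            have h2 : |t| / 2 ≤ |x - t| := by
              have := abs_sub_abs_le_abs_sub t x
              rw [abs_sub_comm] at this
              linarith
            have h3 : t ^ 2 / 4 ≤ (x - t) ^ 2 := by
              rw [← sq_abs t, ← sq_abs (x - t)]
              nlinarith
            have h4 : y * poissonQuotient x y t ≤ 4 * π⁻¹ / t ^ 2 := by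
              rw [poissonQuotient]
              calc y * (π⁻¹ * ((x - t) ^ 2 + y ^ 2)⁻¹)
                  ≤ 1 * (π⁻¹ * (t ^ 2 / 4)⁻¹) := by
                    gcongr
                    nlinarith [sq_nonneg y]
                _ = _ := by field_simp
            exact mul_le_mul h1 h4 (mul_nonneg hy.le (poissonQuotient_nonneg x y t)) hK
          · rw [indicator_of_notMem hx, hout x, ENNReal.ofReal_zero, zero_mul]
            by_contra hcon
            exact hx (abs_le.1 (not_lt.1 hcon))
      _ = ENNReal.ofReal (K₀ * (4 * π⁻¹ / t ^ 2)) * ENNReal.ofReal (2 * R) := by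
          rw [lintegral_indicator_const measurableSet_Icc, Real.volume_Icc]
          congr 2; ring
      _ ≤ _ := by
          rw [← ENNReal.ofReal_mul (by positivity)]
          apply ENNReal.ofReal_le_ofReal
          rw [le_mul_inv_iff₀ (by positivity)]
          have h1 : (t ^ 2)⁻¹ ≤ R⁻¹ ^ 2 := by
            rw [inv_pow, ← sq_abs t]
            gcongr
            linarith
          have h2 : K₀ * (4 * π⁻¹ / t ^ 2) * (2 * R) * (1 + t ^ 2) =
              K₀ * (2 * R) * (4 * π⁻¹) * ((t ^ 2)⁻¹ + 1) := by
            have : t ≠ 0 := abs_pos.1 ht0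
            field_simp
          rw [h2]
          have : 0 ≤ K₀ * (1 + 4 * R ^ 2) := by positivity
          have h3 : K₀ * (2 * R) * (4 * π⁻¹) * ((t ^ 2)⁻¹ + 1) ≤
            K₀ * (2 * R) * (4 * π⁻¹) * (1 + R⁻¹ ^ 2) := by
            apply mul_le_mul_of_nonneg_left _ (by positivity)
            linarith
          linarith

/-- After Tonelli the constant contributes `y A ∫ φ → 0`, and the Poisson part converges by
domination. Nonnegativity of `φ` allows the whole computation in `ℝ≥0∞`; the general case follows by
splitting `φ`. -/
theorem tendsto_integral_mul_im_of_nonneg {f : ℂ → ℂ} (hf : DifferentiableOn ℂ f upperHalf)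
    (hmaps : MapsTo f upperHalf (closure upperHalf)) {A : ℝ≥0∞} (hA : A ≠ ∞) {μ : Measure ℝ}
    (h : HasPoissonRepresentation f A μ) {φ : ℝ → ℝ} (hc : Continuous φ)
    (hs : HasCompactSupport φ) (hφ : ∀ x, 0 ≤ φ x) :
    Tendsto (fun y : ℝ => ∫ x : ℝ, φ x * (f (x + y * Complex.I)).im) (𝓝[>] 0)
      (𝓝 (∫ x, φ x ∂μ)) := by
  have hfin := lintegral_inv_one_add_sq_lt_top h
  have := isLocallyFiniteMeasure_of_lintegral_inv_one_add_sq hfin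
  have him : ∀ z ∈ upperHalf, 0 ≤ (f z).im := by
    intro z hz
    have := hmaps hz
    rwa [upperHalf, Complex.closure_setOfPred_lt_im] at this
  set G : ℝ → ℝ → ℝ≥0∞ := fun y t =>
    ∫⁻ x, ENNReal.ofReal (φ x) * ENNReal.ofReal (y * poissonQuotient x y t) with hG
  have hφm : Measurable fun x => ENNReal.ofReal (φ x) := hc.measurable.ennreal_ofReal
  have hkm : ∀ y, Measurable (Function.uncurry fun x t : ℝ =>
      ENNReal.ofReal (φ x) * ENNReal.ofReal (y * poissonQuotient x y t)) := fun y =>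
    (hφm.comp measurable_fst).mul ((measurable_poissonQuotient_uncurry y).const_mul y).ennreal_ofReal
  have hGm : ∀ y, Measurable (G y) := fun y => Measurable.lintegral_prod_left (hkm y)
  have hint : ∀ y : ℝ, 0 < y → ∫⁻ x : ℝ, ENNReal.ofReal (φ x * (f (x + y * Complex.I)).im) =
      ENNReal.ofReal y * (A * ∫⁻ x, ENNReal.ofReal (φ x)) + ∫⁻ t, G y t ∂μ := by
    intro y hy
    have h1 : ∀ x : ℝ, ENNReal.ofReal (φ x * (f (x + y * Complex.I)).im) =
        ENNReal.ofReal y * A * ENNReal.ofReal (φ x) +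
          ∫⁻ t, ENNReal.ofReal (φ x) * ENNReal.ofReal (y * poissonQuotient x y t) ∂μ := by
      intro x
      have h2 : (f (x + y * Complex.I)).im = y * ((f (x + y * Complex.I)).im / y) := by
        field_simp
      rw [h2, ENNReal.ofReal_mul (hφ x), ENNReal.ofReal_mul hy.le, h x y hy, mul_add, mul_add,
        lintegral_const_mul' _ _ ENNReal.ofReal_ne_top]
      congr 1
      · ring
      · simp_rw [ENNReal.ofReal_mul hy.le]
        rw [lintegral_const_mul' _ _ ENNReal.ofReal_ne_top]
    simp_rw [h1]
    rw [lintegral_add_left (hφm.const_mul _), lintegral_const_mul _ hφm,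
      lintegral_lintegral_swap (hkm y).aemeasurable, mul_assoc]
  have hlim1 : ∀ t, Tendsto (fun y => G y t) (𝓝[>] 0) (𝓝 (ENNReal.ofReal (φ t))) := by
    intro t
    refine (ENNReal.tendsto_ofReal (tendsto_integral_mul_poissonQuotient hc hs t)).congr' ?_
    filter_upwards [self_mem_nhdsWithin] with y hy
    have hy' : 0 < y := hy
    rw [ofReal_integral_eq_lintegral_ofReal]
    · simp_rw [ENNReal.ofReal_mul (hφ _)]
      rfl
    · apply Continuous.integrable_of_hasCompactSupport
      · unfold poissonQuotient
        have : ∀ x : ℝ, (x - t) ^ 2 + y ^ 2 ≠ 0 := fun s => by positivity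
        fun_prop (disch := assumption)
      · exact hs.mul_right
    · exact ae_of_all _ fun x => mul_nonneg (hφ x) (mul_nonneg hy'.le (poissonQuotient_nonneg _ _ _))
  obtain ⟨K, hK⟩ := exists_forall_lintegral_mul_poissonQuotient_le hc hs
  have hlim2 : Tendsto (fun y => ∫⁻ t, G y t ∂μ) (𝓝[>] 0) (𝓝 (∫⁻ t, ENNReal.ofReal (φ t) ∂μ)) := by
    apply tendsto_lintegral_filter_of_dominated_convergence
      (fun t => ENNReal.ofReal K * ENNReal.ofReal (1 + t ^ 2)⁻¹)
    · exact Eventually.of_forall hGm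
    · filter_upwards [Ioc_mem_nhdsGT zero_lt_one] with y hy
      exact ae_of_all _ fun t => hK y hy.1 hy.2 t
    · rw [lintegral_const_mul' _ _ ENNReal.ofReal_ne_top]
      exact (ENNReal.mul_lt_top ENNReal.ofReal_lt_top hfin).ne
    · exact ae_of_all _ hlim1
  have hφfin : ∫⁻ x, ENNReal.ofReal (φ x) ≠ ∞ :=
    (hc.integrable_of_hasCompactSupport hs).lintegral_lt_top.ne
  have hφfin' : ∫⁻ x, ENNReal.ofReal (φ x) ∂μ ≠ ∞ :=
    (hc.integrable_of_hasCompactSupport hs).lintegral_lt_top.ne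
  have hlim3 : Tendsto (fun y : ℝ => ENNReal.ofReal y * (A * ∫⁻ x, ENNReal.ofReal (φ x))) (𝓝[>] 0)
      (𝓝 0) := by
    have h1 : Tendsto (fun y : ℝ => ENNReal.ofReal y) (𝓝[>] 0) (𝓝 0) := by
      have := (ENNReal.continuous_ofReal.tendsto 0).mono_left
        (nhdsWithin_le_nhds (s := Ioi (0 : ℝ)))
      simpa using this
    have h2 := ENNReal.Tendsto.mul_const h1 (Or.inr (ENNReal.mul_ne_top hA hφfin))
    simpa using h2
  have hlim4 := hlim3.add hlim2
  rw [zero_add] at hlim4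
  rw [integral_eq_lintegral_of_nonneg_ae (ae_of_all _ hφ) hc.aestronglyMeasurable]
  refine ((ENNReal.tendsto_toReal hφfin').comp hlim4).congr' ?_
  filter_upwards [self_mem_nhdsWithin] with y hy
  have hy' : 0 < y := hy
  have hmem : ∀ x : ℝ, (x : ℂ) + y * Complex.I ∈ upperHalf := fun x => by
    simpa [upperHalf] using hy'
  rw [Function.comp_apply, ← hint y hy', ← integral_eq_lintegral_of_nonneg_ae]
  · exact ae_of_all _ fun x => mul_nonneg (hφ x) (him _ (hmem x))
  · apply Continuous.aestronglyMeasurable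
    have : Continuous fun x : ℝ => f (x + y * Complex.I) :=
      hf.continuousOn.comp_continuous (by fun_prop) hmem
    exact hc.mul (Complex.continuous_im.comp this)

theorem HasPoissonRepresentation.isNevanlinnaMeasure {f : ℂ → ℂ}
    (hf : DifferentiableOn ℂ f upperHalf) (hmaps : MapsTo f upperHalf (closure upperHalf))
    {A : ℝ≥0∞} (hA : A ≠ ∞) {μ : Measure ℝ} (h : HasPoissonRepresentation f A μ) :
    IsNevanlinnaMeasure f μ := by
  have := isLocallyFiniteMeasure_of_lintegral_inv_one_add_sq (lintegral_inv_one_add_sq_lt_top h)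
  refine ⟨this, fun φ hc hs => ?_⟩
  have hp : HasCompactSupport fun x => max (φ x) 0 := by
    apply hs.comp_left (g := fun s => max s 0); simp
  have hn : HasCompactSupport fun x => max (-φ x) 0 := by
    apply hs.comp_left (g := fun s => max (-s) 0); simp
  have hpc : Continuous fun x => max (φ x) 0 := by fun_prop
  have hnc : Continuous fun x => max (-φ x) 0 := by fun_prop
  have hsub : ∀ s : ℝ, s = max s 0 - max (-s) 0 := fun s => by
    rcases le_total s 0 with h | h <;> simp [h]
  have hlim := (tendsto_integral_mul_im_of_nonneg hf hmaps hA h hpc hp fun x => le_max_right _ _).sub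
    (tendsto_integral_mul_im_of_nonneg hf hmaps hA h hnc hn fun x => le_max_right _ _)
  rw [← integral_sub (hpc.integrable_of_hasCompactSupport hp)
    (hnc.integrable_of_hasCompactSupport hn)] at hlim
  simp_rw [← hsub] at hlim
  refine hlim.congr' ?_
  filter_upwards [self_mem_nhdsWithin] with y hy
  have hy' : 0 < y := hy
  have hmem : ∀ x : ℝ, (x : ℂ) + y * Complex.I ∈ upperHalf := fun x => by
    simpa [upperHalf] using hy'
  have hfc : Continuous fun x : ℝ => (f (x + y * Complex.I)).im :=
    Complex.continuous_im.comp (hf.continuousOn.comp_continuous (by fun_prop) hmem)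
  rw [← integral_sub]
  · simp_rw [← sub_mul, ← hsub]
  · apply Continuous.integrable_of_hasCompactSupport (hpc.mul hfc) hp.mul_right
  · apply Continuous.integrable_of_hasCompactSupport (hnc.mul hfc) hn.mul_right

theorem IsNevanlinnaMeasure.unique {f : ℂ → ℂ} {μ ν : Measure ℝ} (hμ : IsNevanlinnaMeasure f μ)
    (hν : IsNevanlinnaMeasure f ν) : μ = ν := by
  have := hμ.1
  have := hν.1
  exact Measure.ext_of_integral_eq_on_compactlySupported fun φ =>
    tendsto_nhds_unique (hμ.2 φ φ.continuous φ.hasCompactSupport)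
      (hν.2 φ φ.continuous φ.hasCompactSupport)

end Vague

/-! ### Integration by parts for `1/γ`. -/

section Stieltjes

variable {γ : ℝ≥0 → ℝ≥0}

/-- The density of `-d(1/γ)` with respect to `dγ`. -/
noncomputable def invDensity (γ : ℝ≥0 → ℝ≥0) (t : ℝ≥0) : ℝ≥0 :=
  (Function.leftLim γ t * Function.rightLim γ t)⁻¹

theorem measurable_invDensity (hγ : Monotone γ) : Measurable (invDensity γ) :=
  (hγ.leftLim.measurable.mul hγ.rightLim.measurable).inv

theorem dMeasure_Ioc (hγ : Monotone γ) (a b : ℝ≥0) :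
    dMeasure hγ (Ioc a b) = ((Function.rightLim γ b - Function.rightLim γ a : ℝ≥0) : ℝ≥0∞) := by
  have h : ∀ t, Function.rightLim (fun t : ℝ≥0 => (γ t : ℝ)) t = ((Function.rightLim γ t : ℝ≥0) : ℝ) :=
    fun _ => rightLim_eq_of_tendsto
      ((NNReal.continuous_coe.tendsto _).comp (hγ.tendsto_rightLim _))
  rw [dMeasure, StieltjesFunction.measure_Ioc]
  refine (congrArg₂ (fun u v => ENNReal.ofReal (u - v)) (h b) (h a)).trans ?_
  rw [ENNReal.ofReal, NNReal.sub_def]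

instance (hγ : Monotone γ) : IsLocallyFiniteMeasure (dMeasure hγ) := by
  unfold dMeasure; infer_instance

theorem rightLim_pos (hγ : Monotone γ) (hpos : ∀ t, 0 < t → 0 < γ t) {t : ℝ≥0} (ht : 0 < t) :
    0 < Function.rightLim γ t :=
  (hpos t ht).trans_le (hγ.le_rightLim le_rfl)

theorem leftLim_pos (hγ : Monotone γ) (hpos : ∀ t, 0 < t → 0 < γ t) {t : ℝ≥0} (ht : 0 < t) :
    0 < Function.leftLim γ t :=
  (hpos (t / 2) (by positivity)).trans_le (hγ.le_leftLim (NNReal.half_lt_self ht.ne'))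

/-- Fundamental theorem of calculus for `1/γ`. -/
theorem lintegral_invDensity_Ioc (hγ : Monotone γ) (hpos : ∀ t, 0 < t → 0 < γ t) {a b : ℝ≥0}
    (ha : 0 < a) (hab : a < b) :
    ((Function.rightLim γ b)⁻¹ : ℝ≥0) + ∫⁻ t in Ioc a b, invDensity γ t ∂(dMeasure hγ) =
      ((Function.rightLim γ a)⁻¹ : ℝ≥0) := by
  set R := Function.rightLim γ with hR
  have hRm : Monotone R := hγ.rightLim
  set c := b - a with hc
  have hc0 : 0 < c := tsub_pos_of_lt hab
  -- The interval is cut into `n + 1` equal pieces; `k n t` is the index of the half-open piece `(p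
  -- n i, p n (i + 1)]` containing `t`.
  set p : ℕ → ℕ → ℝ≥0 := fun n i => a + c * (i / (n + 1)) with hp
  set k : ℕ → ℝ≥0 → ℕ := fun n t => ⌈(t - a) / c * (n + 1)⌉₊ - 1 with hk
  have hpmono : ∀ n, Monotone (p n) := fun n i j hij => by
    simp only [hp]; gcongr
  have hpa : ∀ n i, a ≤ p n i := fun n i => le_self_add
  have hRpos : ∀ n i, 0 < R (p n i) := fun n i =>
    rightLim_pos hγ hpos (ha.trans_le (hpa n i))
  have hkey : ∀ n t, a < t → p n (k n t) < t ∧ t ≤ p n (k n t + 1) := by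
    intro n t hat
    set s := (t - a) / c * (n + 1) with hs
    have hs0 : 0 < s := by
      have : 0 < t - a := tsub_pos_of_lt hat
      positivity
    have ht : t = a + c * (s / (n + 1)) := by
      rw [hs, mul_div_assoc, div_self (by positivity), mul_one, mul_div_cancel₀ _ hc0.ne',
        add_tsub_cancel_of_le hat.le]
    have hceil : 0 < ⌈s⌉₊ := Nat.ceil_pos.2 hs0
    have hk1 : k n t + 1 = ⌈s⌉₊ := Nat.sub_add_cancel hceil
    constructor
    · have h1 : ((k n t : ℕ) : ℝ≥0) < s := by
        have : k n t < ⌈s⌉₊ := by omega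
        exact Nat.lt_ceil.1 this
      conv_rhs => rw [ht]
      simp only [hp]
      gcongr
    · have h1 : s ≤ ((k n t + 1 : ℕ) : ℝ≥0) := by
        rw [hk1]; exact Nat.le_ceil s
      conv_lhs => rw [ht]
      simp only [hp]
      gcongr
  have hkeq : ∀ n i t, p n i < t → t ≤ p n (i + 1) → k n t = i := by
    intro n i t h1 h2
    obtain ⟨h3, h4⟩ := hkey n t ((hpa n i).trans_lt h1)
    have h5 : i < k n t + 1 := (hpmono n).reflect_lt (h1.trans_le h4)
    have h6 : k n t < i + 1 := (hpmono n).reflect_lt (h3.trans_le h2)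
    omega
  set S : ℕ → ℝ≥0 → ℝ≥0 := fun n t => (R (p n (k n t)) * R (p n (k n t + 1)))⁻¹ with hS
  -- For the step densities the identity is exact and telescopes, since `1/u - 1/v = (v - u)/(uv)`
  -- with `u, v` the values of `R` at consecutive nodes.
  have hstep : ∀ n i, ((R (p n i))⁻¹ : ℝ≥0) +
      ∫⁻ t in Ioc a (p n i), S n t ∂(dMeasure hγ) = ((R a)⁻¹ : ℝ≥0) := by
    intro n i
    induction i with
    | zero => simp [hp]
    | succ i ih =>
      rw [← Ioc_union_Ioc_eq_Ioc (hpa n i) (hpmono n i.le_succ),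
        lintegral_union measurableSet_Ioc (Ioc_disjoint_Ioc_of_le le_rfl), ← ih]
      have h1 : ∫⁻ t in Ioc (p n i) (p n (i + 1)), S n t ∂(dMeasure hγ) =
          ∫⁻ t in Ioc (p n i) (p n (i + 1)), ((R (p n i) * R (p n (i + 1)))⁻¹ : ℝ≥0)
            ∂(dMeasure hγ) := by
        apply setLIntegral_congr_fun measurableSet_Ioc
        intro t ht
        simp only [hS, hkeq n i t ht.1 ht.2]
      rw [h1, setLIntegral_const, dMeasure_Ioc, add_comm (lintegral _ _), ← add_assoc]
      congr 1
      norm_cast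
      have hle : R (p n i) ≤ R (p n (i + 1)) := hRm (hpmono n i.le_succ)
      have h2 := hRpos n i
      have h3 := hRpos n (i + 1)
      rw [← hR]
      obtain ⟨d, hd⟩ := exists_add_of_le hle
      rw [hd] at h3 ⊢
      rw [add_tsub_cancel_left]
      field_simp
  have hpb : ∀ n, p n (n + 1) = b := by
    intro n
    simp only [hp, hc]
    push_cast
    rw [div_self (by positivity), mul_one, add_tsub_cancel_of_le hab.le]
  have hlim : Tendsto (fun n => ∫⁻ t in Ioc a b, S n t ∂(dMeasure hγ)) atTop
      (𝓝 (∫⁻ t in Ioc a b, invDensity γ t ∂(dMeasure hγ))) := by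
    apply tendsto_lintegral_of_dominated_convergence (fun _ => ((R a * R a)⁻¹ : ℝ≥0))
    · intro n
      apply Measurable.coe_nnreal_ennreal
      have hkm : Measurable (k n) := by
        have h1 : Measurable fun t : ℝ≥0 => (t - a) / c * (n + 1) := by fun_prop
        exact (measurable_from_nat (f := fun m : ℕ => m - 1)).comp (Nat.measurable_ceil.comp h1)
      exact (measurable_from_nat (f := fun m : ℕ => (R (p n m) * R (p n (m + 1)))⁻¹)).comp hkm
    · intro n
      refine ae_of_all _ fun t => ?_
      have h1 := hRm (hpa n (k n t))
      have h2 := hRm (hpa n (k n t + 1))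
      have h3 : 0 < R a := rightLim_pos hγ hpos ha
      simp only [hS]
      gcongr
    · rw [setLIntegral_const, dMeasure_Ioc]
      exact ENNReal.mul_ne_top ENNReal.coe_ne_top ENNReal.coe_ne_top
    · refine (ae_restrict_iff' measurableSet_Ioc).2 (ae_of_all _ fun t ht => ?_)
      rw [ENNReal.tendsto_coe, invDensity]
      have ht0 : 0 < t := ha.trans ht.1
      have hgap : ∀ n, p n (k n t + 1) = p n (k n t) + c * (1 / (n + 1)) := by
        intro n
        simp only [hp]
        push_cast
        rw [add_div, mul_add, add_assoc]
      have hc' : Tendsto (fun n : ℕ => c * (1 / ((n : ℝ≥0) + 1))) atTop (𝓝 0) := by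
        have := (tendsto_one_div_add_atTop_nhds_zero_nat (𝕜 := ℝ≥0)).const_mul c
        simpa using this
      have t1 : Tendsto (fun n => p n (k n t)) atTop (𝓝[<] t) := by
        refine tendsto_nhdsWithin_iff.2 ⟨?_, Eventually.of_forall fun n => (hkey n t ht.1).1⟩
        have h1 : Tendsto (fun n : ℕ => t - c * (1 / ((n : ℝ≥0) + 1))) atTop (𝓝 t) := by
          have := (tendsto_const_nhds (x := t)).sub hc'
          simpa using this
        apply tendsto_of_tendsto_of_tendsto_of_le_of_le h1 tendsto_const_nhds
        · intro n
          have := (hkey n t ht.1).2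
          rw [hgap] at this
          exact tsub_le_iff_right.2 this
        · exact fun n => (hkey n t ht.1).1.le
      have t2 : Tendsto (fun n => p n (k n t + 1)) atTop (𝓝[≥] t) := by
        refine tendsto_nhdsWithin_iff.2 ⟨?_, Eventually.of_forall fun n => (hkey n t ht.1).2⟩
        simp_rw [hgap]
        have := (t1.mono_right nhdsWithin_le_nhds).add hc'
        simpa using this
      -- The left node stays strictly below `t` and the right node at or above it. This is what
      -- produces the product `γ(t-) γ(t+)` at jumps.
      have l1 : Tendsto R (𝓝[<] t) (𝓝 (Function.leftLim γ t)) := by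
        have hRt := hRm.tendsto_leftLim t
        have : (𝓝[<] t).NeBot := nhdsLT_neBot_of_exists_lt ⟨0, ht0⟩
        rwa [hR, leftLim_rightLim (hγ.tendsto_leftLim t)] at hRt
      have l2 : Tendsto R (𝓝[≥] t) (𝓝 (R t)) :=
        continuousWithinAt_rightLim_Ici (hγ.tendsto_rightLim t)
      exact ((l1.comp t1).mul (l2.comp t2)).inv₀
        (mul_pos (leftLim_pos hγ hpos ht0) (rightLim_pos hγ hpos ht0)).ne'
  have h1 : Tendsto (fun n => ((R b)⁻¹ : ℝ≥0) + ∫⁻ t in Ioc a b, S n t ∂(dMeasure hγ)) atTop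
      (𝓝 (((R b)⁻¹ : ℝ≥0) + ∫⁻ t in Ioc a b, invDensity γ t ∂(dMeasure hγ))) :=
    hlim.const_add _
  refine tendsto_nhds_unique h1 (tendsto_const_nhds.congr fun n => ?_)
  have := hstep n (n + 1)
  rw [hpb] at this
  exact this.symm

end Stieltjes

/-! ### Distances, arcs and averages in the half plane made explicit. -/

section Geometry

theorem infDist_frontier_upperHalf (z : ℂ) : Metric.infDist z (frontier upperHalf) = |z.im| := by
  rw [upperHalf, Complex.frontier_setOfPred_lt_im]
  apply le_antisymm
  · have h1 : (z.re : ℂ) ∈ {z : ℂ | z.im = 0} := by simp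
    refine (Metric.infDist_le_dist_of_mem h1).trans ?_
    rw [Complex.dist_of_re_eq (by simp)]
    simp
  · rw [Metric.le_infDist ⟨0, by simp⟩]
    intro w hw
    have hw' : w.im = 0 := hw
    rw [Complex.dist_eq]
    have := Complex.abs_im_le_norm (z - w)
    rwa [Complex.sub_im, hw', sub_zero] at this

theorem tangentialDist_upperHalf (τ : ℝ) (z : ℂ) :
    tangentialDist upperHalf τ z = |z.re - τ| := by
  rw [tangentialDist, infDist_frontier_upperHalf, Complex.dist_eq, Complex.sq_norm,
    Complex.normSq_apply, sq_abs, ← Real.sqrt_sq_eq_abs]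
  congr 1
  simp
  ring

theorem im_nonneg_of_mapsTo {f : ℂ → ℂ} (hmaps : MapsTo f upperHalf (closure upperHalf)) {z : ℂ}
    (hz : 0 < z.im) : 0 ≤ (f z).im := by
  have := hmaps (x := z) hz
  rwa [upperHalf, Complex.closure_setOfPred_lt_im] at this

theorem juliaQuotient_upperHalf {f : ℂ → ℂ} (hmaps : MapsTo f upperHalf (closure upperHalf))
    {z : ℂ} (hz : 0 < z.im) :
    juliaQuotient upperHalf upperHalf f z = (f z).im / z.im := by
  rw [juliaQuotient, infDist_frontier_upperHalf, infDist_frontier_upperHalf, abs_of_pos hz,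
    abs_of_nonneg (im_nonneg_of_mapsTo hmaps hz)]

theorem arc_upperHalf {lam : ℝ≥0 → ℝ≥0} (τ : ℝ) {d : ℝ≥0} (h : 0 < lam d) :
    arc upperHalf lam τ d =
      (fun x : ℝ => (x : ℂ) + (lam d : ℝ) * Complex.I) '' Icc (τ - d) (τ + d) := by
  have h' : (0 : ℝ) < lam d := h
  ext z
  simp only [arc, infDist_frontier_upperHalf, tangentialDist_upperHalf, mem_ofPred_eq, mem_image]
  constructor
  · rintro ⟨h1, h2, h3⟩
    rw [abs_of_pos (show 0 < z.im from h1)] at h2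
    rw [abs_le] at h3
    refine ⟨z.re, ⟨by linarith [h3.1], by linarith [h3.2]⟩, ?_⟩
    rw [← h2]
    exact Complex.re_add_im z
  · rintro ⟨x, hx, rfl⟩
    simp only [Complex.add_im, Complex.ofReal_im, Complex.mul_im, Complex.ofReal_re, Complex.I_im,
      mul_one, Complex.I_re, mul_zero, add_zero, zero_add, Complex.add_re, Complex.mul_re,
      sub_zero]
    refine ⟨by simpa [upperHalf] using h', abs_of_pos h', ?_⟩
    rw [abs_le]
    constructor <;> linarith [hx.1, hx.2]

/-- The arc is an isometric image of a real interval, so one-dimensional Hausdorff measure becomes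
Lebesgue measure. -/
theorem ofReal_amortizedJulia {f : ℂ → ℂ} (hf : DifferentiableOn ℂ f upperHalf)
    (hmaps : MapsTo f upperHalf (closure upperHalf)) {lam : ℝ≥0 → ℝ≥0} (τ : ℝ) {d : ℝ≥0}
    (hd : 0 < d) (h : 0 < lam d) :
    ENNReal.ofReal (amortizedJulia upperHalf upperHalf f lam τ d) =
      ENNReal.ofReal (2 * d)⁻¹ * ∫⁻ x in Icc (τ - d) (τ + d),
        ENNReal.ofReal ((f ((x : ℂ) + (lam d : ℝ) * Complex.I)).im / lam d) := by
  have h' : (0 : ℝ) < lam d := h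
  have hd' : (0 : ℝ) < d := hd
  set e : ℝ → ℂ := fun x : ℝ => (x : ℂ) + (lam d : ℝ) * Complex.I with he
  have hiso : Isometry e := by
    apply Isometry.of_dist_eq
    intro x y
    simp [he, Complex.dist_eq, Real.dist_eq, ← Complex.ofReal_sub]
  have hemb : MeasurableEmbedding e := hiso.isClosedEmbedding.measurableEmbedding
  have him : ∀ x, (e x).im = lam d := fun x => by simp [he]
  have hcont : Continuous fun x => (f (e x)).im := by
    apply Complex.continuous_im.comp (hf.continuousOn.comp_continuous hiso.continuous fun x => ?_)
    rw [upperHalf, mem_ofPred_eq, him]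
    exact h'
  have hmeas : (Measure.hausdorffMeasure 1 : Measure ℂ).restrict (arc upperHalf lam τ d) =
      (volume.restrict (Icc (τ - d) (τ + d))).map e := by
    rw [arc_upperHalf τ h, ← hausdorffMeasure_real]
    ext s hs
    rw [Measure.restrict_apply hs, hemb.map_apply, Measure.restrict_apply (hemb.measurable hs),
      ← hiso.hausdorffMeasure_image (Or.inl zero_le_one), image_preimage_inter]
  have hvol : ((volume.restrict (Icc (τ - d) (τ + d))).map e).real univ = 2 * d := by
    rw [measureReal_def, hemb.map_apply, preimage_univ, Measure.restrict_apply MeasurableSet.univ,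
      univ_inter, Real.volume_Icc, ENNReal.toReal_ofReal (by linarith)]
    ring
  have hJ : ∀ x, juliaQuotient upperHalf upperHalf f (e x) = (f (e x)).im / lam d := by
    intro x
    rw [juliaQuotient_upperHalf hmaps (by rw [him]; exact h'), him]
  rw [amortizedJulia, average_eq, hmeas, hvol, smul_eq_mul, ENNReal.ofReal_mul (by positivity),
    hemb.integral_map]
  simp_rw [hJ]
  rw [ofReal_integral_eq_lintegral_ofReal]
  · exact (hcont.div_const _).continuousOn.integrableOn_compact isCompact_Icc
  · refine ae_of_all _ fun x => div_nonneg (im_nonneg_of_mapsTo hmaps ?_) h'.le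
    rw [him]
    exact h'

end Geometry

/-! ### Julia quotients compared with masses of intervals about `τ`. -/

section Estimates

open Real

variable {f : ℂ → ℂ} {A : ℝ≥0∞} {μ : Measure ℝ}

theorem HasPoissonRepresentation.isLocallyFiniteMeasure (h : HasPoissonRepresentation f A μ) :
    IsLocallyFiniteMeasure μ :=
  isLocallyFiniteMeasure_of_lintegral_inv_one_add_sq (lintegral_inv_one_add_sq_lt_top h)

theorem le_setLIntegral_poissonQuotient {τ d y t : ℝ} (hy : 0 < y) (hyd : y ≤ d)
    (ht : t ∈ Icc (τ - d) (τ + d)) :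
    ENNReal.ofReal ((2 * π)⁻¹ * y⁻¹) ≤
      ∫⁻ x in Icc (τ - d) (τ + d), ENNReal.ofReal (poissonQuotient x y t) := by
  -- The piece of length `y` adjacent to `t` on the side of `τ` stays in the interval; there the
  -- kernel is at least `(2π y²)⁻¹`.
  obtain ⟨s, hs1, hs2⟩ : ∃ s, Icc s (s + y) ⊆ Icc (τ - d) (τ + d) ∧ Icc s (s + y) ⊆ Icc (t - y) (t + y) := by
    rcases le_total τ t with h | h
    · exact ⟨t - y, Icc_subset_Icc (by linarith) (by linarith [ht.2]),
        Icc_subset_Icc le_rfl (by linarith)⟩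
    · exact ⟨t, Icc_subset_Icc ht.1 (by linarith), Icc_subset_Icc (by linarith) le_rfl⟩
  calc ENNReal.ofReal ((2 * π)⁻¹ * y⁻¹)
      = ∫⁻ x in Icc s (s + y), ENNReal.ofReal ((2 * π)⁻¹ * (y ^ 2)⁻¹) := by
        rw [setLIntegral_const, Real.volume_Icc, ← ENNReal.ofReal_mul (by positivity)]
        congr 1
        field_simp
        ring
    _ ≤ ∫⁻ x in Icc s (s + y), ENNReal.ofReal (poissonQuotient x y t) := by
        apply setLIntegral_mono' measurableSet_Icc
        intro x hx
        apply ENNReal.ofReal_le_ofReal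
        have h1 := hs2 hx
        have h2 : (x - t) ^ 2 ≤ y ^ 2 := sq_le_sq' (by linarith [h1.1]) (by linarith [h1.2])
        rw [poissonQuotient, mul_comm 2 π, mul_inv, mul_assoc, ← mul_inv]
        gcongr
        linarith
    _ ≤ _ := lintegral_mono_set hs1

theorem HasPoissonRepresentation.measure_le_setLIntegral (h : HasPoissonRepresentation f A μ)
    {τ d y : ℝ} (hy : 0 < y) (hyd : y ≤ d) :
    ENNReal.ofReal ((2 * π)⁻¹ * y⁻¹) * μ (Icc (τ - d) (τ + d)) ≤
      ∫⁻ x in Icc (τ - d) (τ + d), ENNReal.ofReal ((f (x + y * Complex.I)).im / y) := by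
  have := h.isLocallyFiniteMeasure
  calc ENNReal.ofReal ((2 * π)⁻¹ * y⁻¹) * μ (Icc (τ - d) (τ + d))
      = ∫⁻ t in Icc (τ - d) (τ + d), ENNReal.ofReal ((2 * π)⁻¹ * y⁻¹) ∂μ := by
        rw [setLIntegral_const]
    _ ≤ ∫⁻ t in Icc (τ - d) (τ + d), ∫⁻ x in Icc (τ - d) (τ + d),
          ENNReal.ofReal (poissonQuotient x y t) ∂volume ∂μ :=
        setLIntegral_mono' measurableSet_Icc fun t ht => le_setLIntegral_poissonQuotient hy hyd ht
    _ = ∫⁻ x in Icc (τ - d) (τ + d), ∫⁻ t in Icc (τ - d) (τ + d),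
          ENNReal.ofReal (poissonQuotient x y t) ∂μ :=
        (lintegral_lintegral_swap (measurable_poissonQuotient_uncurry y).ennreal_ofReal.aemeasurable).symm
    _ ≤ _ := by
        apply lintegral_mono
        intro x
        beta_reduce
        rw [h x y hy]
        exact (setLIntegral_le_lintegral _ _).trans le_add_self

/-- The measure of the interval of radius `d` about `τ` is controlled by the amortized Julia
quotient. -/
theorem HasPoissonRepresentation.measure_le_of_amortizedJulia
    (h : HasPoissonRepresentation f A μ) (hf : DifferentiableOn ℂ f upperHalf)
    (hmaps : MapsTo f upperHalf (closure upperHalf)) {lam : ℝ≥0 → ℝ≥0} {τ : ℝ}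
    (hlam : (fun t : ℝ≥0 => (lam t : ℝ)) =o[𝓝[>] 0] (fun t : ℝ≥0 => (t : ℝ)))
    (hJ : AmortizedJuliaBounded f lam τ) :
    ∃ K : ℝ≥0, ∀ᶠ d : ℝ≥0 in 𝓝[>] 0, μ (Icc (τ - d) (τ + d)) ≤ (K * (d * lam d) : ℝ≥0) := by
  obtain ⟨M, hM⟩ := hJ
  -- `4π = 2 · 2π`: one factor is the length `2d` of the averaging segment, the other the kernel
  -- bound.
  refine ⟨Real.toNNReal (4 * π * max M 0), ?_⟩
  filter_upwards [hM, hlam.bound one_pos, self_mem_nhdsWithin] with d h1 h2 hd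
  obtain ⟨hpos, hAJ⟩ := h1
  have hd : (0 : ℝ) < d := hd
  have hl : (0 : ℝ) < lam d := hpos
  have hle : (lam d : ℝ) ≤ d := by simpa using h2
  have h3 := ofReal_amortizedJulia hf hmaps τ hd hpos
  have h4 := h.measure_le_setLIntegral (τ := τ) hl hle
  have h5 : ENNReal.ofReal (2 * d)⁻¹ * (ENNReal.ofReal ((2 * π)⁻¹ * (lam d : ℝ)⁻¹) *
      μ (Icc (τ - d) (τ + d))) ≤ ENNReal.ofReal (max M 0) := by
    calc _ ≤ _ := by gcongr
      _ = _ := h3.symm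
      _ ≤ _ := ENNReal.ofReal_le_ofReal (hAJ.trans (le_max_left _ _))
  rw [← mul_assoc, ← ENNReal.ofReal_mul (by positivity)] at h5
  have h6 : ((Real.toNNReal (4 * π * max M 0) * (d * lam d) : ℝ≥0) : ℝ≥0∞) =
      ENNReal.ofReal (4 * π * (d * lam d)) * ENNReal.ofReal (max M 0) := by
    rw [← ENNReal.ofReal_mul (by positivity), ← ENNReal.ofReal_coe_nnreal]
    congr 1
    push_cast
    rw [Real.coe_toNNReal _ (by positivity)]
    ring
  rw [h6]
  calc μ (Icc (τ - d) (τ + d)) = ENNReal.ofReal (4 * π * (d * lam d)) *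
        (ENNReal.ofReal ((2 * (d : ℝ))⁻¹ * ((2 * π)⁻¹ * (lam d : ℝ)⁻¹)) * μ (Icc (τ - d) (τ + d))) := by
        rw [← mul_assoc, ← ENNReal.ofReal_mul (by positivity)]
        have : 4 * π * ((d : ℝ) * lam d) * ((2 * (d : ℝ))⁻¹ * ((2 * π)⁻¹ * (lam d : ℝ)⁻¹)) = 1 := by
          field_simp
          norm_num
        rw [this, ENNReal.ofReal_one, one_mul]
    _ ≤ _ := by gcongr

/-- Points of the line at distance more than `2 r` from `τ` contribute a bounded amount to the
Julia quotient over the interval of radius `r`. -/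
theorem HasPoissonRepresentation.le_near_add_far (h : HasPoissonRepresentation f A μ)
    {τ x y r : ℝ} (hy : 0 < y) (hx : |x - τ| ≤ r) :
    ENNReal.ofReal ((f (x + y * Complex.I)).im / y) ≤
      (A + ENNReal.ofReal (4 / π) * ∫⁻ t, ((Real.nnabs (t - τ) : ℝ≥0∞) ^ 2)⁻¹ ∂μ) +
        ∫⁻ t in Icc (τ - 2 * r) (τ + 2 * r), ENNReal.ofReal (poissonQuotient x y t) ∂μ := by
  have hq := (measurable_poissonQuotient x y).ennreal_ofReal
  rw [h x y hy, add_assoc, ← lintegral_indicator measurableSet_Icc,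
    ← lintegral_const_mul' _ _ ENNReal.ofReal_ne_top,
    ← lintegral_add_right _ (hq.indicator measurableSet_Icc)]
  gcongr with t
  by_cases ht : t ∈ Icc (τ - 2 * r) (τ + 2 * r)
  · rw [indicator_of_mem ht]
    exact le_add_self
  · rw [indicator_of_notMem ht, add_zero]
    have h1 : 2 * r < |t - τ| := by
      by_contra hcon
      rw [not_lt, abs_le] at hcon
      exact ht ⟨by linarith [hcon.1], by linarith [hcon.2]⟩
    have hr : 0 ≤ r := (abs_nonneg _).trans hx
    have h2 : |t - τ| / 2 ≤ |x - t| := by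
      have := abs_sub_le t x τ
      rw [abs_sub_comm t x] at this
      linarith
    have h3 : 0 < |t - τ| := by linarith
    have h4 : (t - τ) ^ 2 / 4 ≤ (x - t) ^ 2 := by
      rw [← sq_abs (t - τ), ← sq_abs (x - t)]
      nlinarith
    have h5 : (((Real.nnabs (t - τ) : ℝ≥0∞) ^ 2)⁻¹) = ENNReal.ofReal (((t - τ) ^ 2)⁻¹) := by
      rw [ENNReal.ofReal_inv_of_pos (by rw [← sq_abs]; positivity), ← sq_abs,
        ENNReal.ofReal_pow (abs_nonneg _)]
      congr 2
      rw [← Real.coe_nnabs, ENNReal.ofReal_coe_nnreal]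
    rw [h5, ← ENNReal.ofReal_mul (by positivity)]
    apply ENNReal.ofReal_le_ofReal
    have h6 : 0 < (t - τ) ^ 2 := by rw [← sq_abs]; positivity
    calc poissonQuotient x y t ≤ π⁻¹ * ((t - τ) ^ 2 / 4)⁻¹ := by
          rw [poissonQuotient]
          gcongr
          nlinarith [sq_nonneg y]
      _ = _ := by
        have : t - τ ≠ 0 := abs_pos.1 h3
        field_simp

/-- Pointwise version: near `τ` the kernel is at most `y⁻²`. -/
theorem HasPoissonRepresentation.le_add_measure (h : HasPoissonRepresentation f A μ)
    {τ x y r : ℝ} (hy : 0 < y) (hx : |x - τ| ≤ r) :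
    ENNReal.ofReal ((f (x + y * Complex.I)).im / y) ≤
      (A + ENNReal.ofReal (4 / π) * ∫⁻ t, ((Real.nnabs (t - τ) : ℝ≥0∞) ^ 2)⁻¹ ∂μ) +
        ENNReal.ofReal (y ^ 2)⁻¹ * μ (Icc (τ - 2 * r) (τ + 2 * r)) := by
  refine (h.le_near_add_far hy hx).trans ?_
  gcongr
  rw [← setLIntegral_const]
  gcongr with t
  rw [poissonQuotient]
  calc π⁻¹ * ((x - t) ^ 2 + y ^ 2)⁻¹ ≤ 1 * (y ^ 2)⁻¹ := by
        gcongr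
        · exact inv_le_one_of_one_le₀ (by linarith [pi_gt_three])
        · nlinarith [sq_nonneg (x - t)]
    _ = _ := one_mul _

/-- Integrating the near part in `x` first costs at most `1/λ(d)` per unit of mass, against `y⁻²`
pointwise. This gain is the point of averaging. -/
theorem HasPoissonRepresentation.amortizedJuliaBounded (h : HasPoissonRepresentation f A μ)
    (hA : A ≠ ∞) (hf : DifferentiableOn ℂ f upperHalf)
    (hmaps : MapsTo f upperHalf (closure upperHalf)) {lam : ℝ≥0 → ℝ≥0} {τ : ℝ}
    (hS : ∫⁻ t, ((Real.nnabs (t - τ) : ℝ≥0∞) ^ 2)⁻¹ ∂μ ≠ ∞) {K : ℝ≥0}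
    (hK : ∀ᶠ d in 𝓝[>] (0 : ℝ≥0), 0 < lam d ∧
      μ (Icc (τ - 2 * d) (τ + 2 * d)) ≤ (K * (d * lam d) : ℝ≥0)) :
    AmortizedJuliaBounded f lam τ := by
  have := h.isLocallyFiniteMeasure
  set B : ℝ≥0∞ := A + ENNReal.ofReal (4 / π) * ∫⁻ t, ((Real.nnabs (t - τ) : ℝ≥0∞) ^ 2)⁻¹ ∂μ
    with hB
  have hBfin : B ≠ ∞ := ENNReal.add_ne_top.2 ⟨hA, ENNReal.mul_ne_top ENNReal.ofReal_ne_top hS⟩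
  refine ⟨(B + K).toReal, ?_⟩
  filter_upwards [hK, self_mem_nhdsWithin] with d h1 hd
  obtain ⟨hl, hm⟩ := h1
  refine ⟨hl, ?_⟩
  have hd' : (0 : ℝ) < d := hd
  have hl' : (0 : ℝ) < lam d := hl
  rw [← ENNReal.ofReal_le_iff_le_toReal (ENNReal.add_ne_top.2 ⟨hBfin, ENNReal.coe_ne_top⟩),
    ofReal_amortizedJulia hf hmaps τ hd hl]
  have hkey : ∫⁻ x in Icc (τ - d) (τ + d),
      ENNReal.ofReal ((f ((x : ℂ) + (lam d : ℝ) * Complex.I)).im / lam d) ≤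
        B * ENNReal.ofReal (2 * d) + ENNReal.ofReal (lam d : ℝ)⁻¹ * (K * (d * lam d) : ℝ≥0) := by
    calc _ ≤ ∫⁻ x in Icc (τ - d) (τ + d), (B +
          ∫⁻ t in Icc (τ - 2 * d) (τ + 2 * d), ENNReal.ofReal (poissonQuotient x (lam d) t) ∂μ) := by
          apply setLIntegral_mono' measurableSet_Icc
          intro x hx
          apply h.le_near_add_far hl'
          rw [abs_le]
          constructor <;> linarith [hx.1, hx.2]
      _ = B * ENNReal.ofReal (2 * d) + ∫⁻ x in Icc (τ - d) (τ + d),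
          ∫⁻ t in Icc (τ - 2 * d) (τ + 2 * d), ENNReal.ofReal (poissonQuotient x (lam d) t) ∂μ := by
          rw [lintegral_add_left measurable_const, setLIntegral_const, Real.volume_Icc]
          congr 3
          ring
      _ ≤ B * ENNReal.ofReal (2 * d) + ENNReal.ofReal (lam d : ℝ)⁻¹ *
          μ (Icc (τ - 2 * d) (τ + 2 * d)) := by
          gcongr
          rw [lintegral_lintegral_swap
            (measurable_poissonQuotient_uncurry _).ennreal_ofReal.aemeasurable, ← setLIntegral_const]
          gcongr with t
          exact (setLIntegral_le_lintegral _ _).trans (lintegral_poissonQuotient hl' t).le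
      _ ≤ _ := by gcongr
  calc _ ≤ ENNReal.ofReal (2 * (d : ℝ))⁻¹ *
        (B * ENNReal.ofReal (2 * d) + ENNReal.ofReal (lam d : ℝ)⁻¹ * (K * (d * lam d) : ℝ≥0)) := by
        gcongr
    _ = B * ENNReal.ofReal ((2 * (d : ℝ))⁻¹ * (2 * d)) +
        ENNReal.ofReal ((2 * (d : ℝ))⁻¹ * ((lam d : ℝ)⁻¹ * (K * (d * lam d)))) := by
        rw [ENNReal.ofReal_mul (p := (2 * (d : ℝ))⁻¹) (q := 2 * d) (by positivity),
          ENNReal.ofReal_mul (p := (2 * (d : ℝ))⁻¹) (by positivity),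
          ENNReal.ofReal_mul (p := (lam d : ℝ)⁻¹) (by positivity),
          ← ENNReal.ofReal_coe_nnreal (p := K * (d * lam d))]
        push_cast
        ring
    _ ≤ B + K := by
        rw [inv_mul_cancel₀ (by positivity), ENNReal.ofReal_one, mul_one]
        gcongr
        rw [← ENNReal.ofReal_coe_nnreal]
        apply ENNReal.ofReal_le_ofReal
        have : (2 * (d : ℝ))⁻¹ * ((lam d : ℝ)⁻¹ * (K * (d * lam d))) = K / 2 := by
          field_simp
        rw [this]
        linarith [K.coe_nonneg]

/-- The Julia quotient decreases along vertical lines. -/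
theorem HasPoissonRepresentation.anti (h : HasPoissonRepresentation f A μ)
    {x y y' : ℝ} (hy : 0 < y) (hyy' : y ≤ y') :
    ENNReal.ofReal ((f (x + y' * Complex.I)).im / y') ≤
      ENNReal.ofReal ((f (x + y * Complex.I)).im / y) := by
  rw [h x y hy, h x y' (hy.trans_le hyy')]
  gcongr with t
  unfold poissonQuotient
  gcongr

end Estimates

/-! ### From mass bounds by an augury to regularity. -/

section Regularity

variable {γ : ℝ≥0 → ℝ≥0} {lam : ℝ≥0 → ℝ≥0} {f : ℂ → ℂ} {A : ℝ≥0∞} {μ : Measure ℝ} {τ : ℝ}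

theorem eventually_nhdsGT_zero_iff {P : ℝ≥0 → Prop} :
    (∀ᶠ d in 𝓝[>] (0 : ℝ≥0), P d) ↔ ∃ δ : ℝ≥0, 0 < δ ∧ ∀ d, 0 < d → d < δ → P d := by
  rw [Filter.Eventually, mem_nhdsGT_iff_exists_Ioo_subset]
  constructor
  · rintro ⟨δ, hδ, h⟩
    exact ⟨δ, hδ, fun d h1 h2 => h ⟨h1, h2⟩⟩
  · rintro ⟨δ, hδ, h⟩
    exact ⟨δ, hδ, fun d hd => h d hd.1 hd.2⟩

theorem nnabs_le_iff_mem_Icc {t : ℝ} {d : ℝ≥0} :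
    Real.nnabs (t - τ) ≤ d ↔ t ∈ Icc (τ - d) (τ + d) := by
  rw [← NNReal.coe_le_coe, Real.coe_nnabs, abs_le]
  constructor
  · rintro ⟨h1, h2⟩; exact ⟨by linarith, by linarith⟩
  · rintro ⟨h1, h2⟩; exact ⟨by linarith, by linarith⟩

theorem measurable_nnabs_sub : Measurable fun t : ℝ => Real.nnabs (t - τ) := by
  have : (fun t : ℝ => Real.nnabs (t - τ)) = fun t => ‖t - τ‖₊ := by
    ext t; simp
  rw [this]
  fun_prop

theorem exists_le_mul_sq (hO : (fun t : ℝ≥0 => (γ t : ℝ)) =O[𝓝[>] 0] (fun t : ℝ≥0 => (t : ℝ) ^ 2)) :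
    ∃ K : ℝ≥0, 0 < K ∧ ∃ δ : ℝ≥0, 0 < δ ∧ ∀ t, 0 < t → t < δ → γ t ≤ K * t ^ 2 := by
  obtain ⟨K, hK, h⟩ := hO.exists_pos
  obtain ⟨δ, hδ, h⟩ := eventually_nhdsGT_zero_iff.1 h.bound
  refine ⟨K.toNNReal, Real.toNNReal_pos.2 hK, δ, hδ, fun t h1 h2 => ?_⟩
  have := h t h1 h2
  rw [← NNReal.coe_le_coe, NNReal.coe_mul, Real.coe_toNNReal _ hK.le]
  simpa using this

theorem map_zero_of_isBigO (hγ : Monotone γ)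
    (hO : (fun t : ℝ≥0 => (γ t : ℝ)) =O[𝓝[>] 0] (fun t : ℝ≥0 => (t : ℝ) ^ 2)) : γ 0 = 0 := by
  obtain ⟨K, -, δ, hδ, h⟩ := exists_le_mul_sq hO
  have h1 : Tendsto (fun t : ℝ≥0 => K * t ^ 2) (𝓝[>] 0) (𝓝 0) := by
    have : ContinuousAt (fun t : ℝ≥0 => K * t ^ 2) 0 := by fun_prop
    simpa using this.tendsto.mono_left nhdsWithin_le_nhds
  refine le_antisymm (ge_of_tendsto h1 ?_) zero_le
  rw [eventually_nhdsGT_zero_iff]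
  exact ⟨δ, hδ, fun t h1 h2 => (hγ zero_le).trans (h t h1 h2)⟩

theorem enorm_augury_integrand (C t : ℝ≥0) :
    ‖((t * lam (C * t) / (Function.leftLim γ t * Function.rightLim γ t) : ℝ≥0) : ℝ)‖ₑ =
      ((t * lam (C * t) * invDensity γ t : ℝ≥0) : ℝ≥0∞) := by
  rw [invDensity, ← div_eq_mul_inv, enorm_eq_nnnorm, NNReal.nnnorm_eq]

theorem IsAugury.exists_lintegral_lt_top {hγ : Monotone γ} (h : IsAugury hγ lam) :
    ∃ C : ℝ≥0, 0 < C ∧ ∫⁻ t in Ico 0 1, ((t * lam (C * t) * invDensity γ t : ℝ≥0) : ℝ≥0∞)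
      ∂(dMeasure hγ) < ∞ := by
  obtain ⟨-, C, hC, hint⟩ := h
  refine ⟨C, hC, ?_⟩
  have := hint.2
  rw [HasFiniteIntegral] at this
  simpa only [enorm_augury_integrand] using this

theorem isAugury_of_lintegral_lt_top (hγ : Monotone γ) (hlam : Measurable lam)
    (ho : (fun t : ℝ≥0 => (lam t : ℝ)) =o[𝓝[>] 0] (fun t : ℝ≥0 => (t : ℝ))) {C : ℝ≥0} (hC : 0 < C)
    (h : ∫⁻ t in Ico 0 1, ((t * lam (C * t) * invDensity γ t : ℝ≥0) : ℝ≥0∞) ∂(dMeasure hγ) < ∞) :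
    IsAugury hγ lam := by
  refine ⟨ho, C, hC, ?_, ?_⟩
  · apply Measurable.aestronglyMeasurable
    have h1 : Measurable fun t : ℝ≥0 => lam (C * t) := hlam.comp (measurable_const_mul C)
    have h2 := hγ.leftLim.measurable
    have h3 := hγ.rightLim.measurable
    fun_prop
  · rw [HasFiniteIntegral]
    simpa only [enorm_augury_integrand] using h

theorem inv_le_inv_rightLim_add (hγ : Monotone γ) (hpos : ∀ t, 0 < t → 0 < γ t) {s a b : ℝ≥0}
    (ha : 0 < a) (has : a < s) (hab : a < b) :
    ((γ s : ℝ≥0∞))⁻¹ ≤ ((Function.rightLim γ b)⁻¹ : ℝ≥0) +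
      ∫⁻ t in Ioc a b, invDensity γ t ∂(dMeasure hγ) := by
  rw [lintegral_invDensity_Ioc hγ hpos ha hab,
    ENNReal.coe_inv (rightLim_pos hγ hpos ha).ne']
  exact ENNReal.inv_le_inv.2 (ENNReal.coe_le_coe.2 (hγ.rightLim_le has))

/-- With `r = |t - τ|`, write `1/γ(cr)` as at most a constant plus `∫ d(-1/γ)` over `(cr/2, b]`.
Tonelli turns this into `∫ m(Cs) d(-1/γ)(s)`, with `m` the mass of the interval about `τ`, and the
hypothesis bounds it by the augury integral. -/
theorem isRegularAt_of_measure_le (hγ : Monotone γ) (hpos : ∀ t, 0 < t → 0 < γ t)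
    (hμ : IsNevanlinnaMeasure f μ) (hlam : IsAugury hγ lam) {K : ℝ≥0}
    (hK : ∀ᶠ d : ℝ≥0 in 𝓝[>] 0, μ (Icc (τ - d) (τ + d)) ≤ (K * (d * lam d) : ℝ≥0)) :
    IsRegularAt γ f τ := by
  have := hμ.1
  obtain ⟨C, hC, hint⟩ := hlam.exists_lintegral_lt_top
  obtain ⟨δ, hδ, hF⟩ := eventually_nhdsGT_zero_iff.1 hK
  -- `b < 1` keeps the integral inside the augury's domain, and `C b < δ` keeps the mass bound
  -- available.
  set b : ℝ≥0 := min (1 / 2) (δ / (2 * C)) with hb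
  have hb0 : 0 < b := by
    rw [hb]; exact lt_min (by positivity) (by positivity)
  have hb1 : b < 1 := (min_le_left _ _).trans_lt (by
    rw [← NNReal.coe_lt_coe]; norm_num)
  have hbδ : C * b < δ := by
    calc C * b ≤ C * (δ / (2 * C)) := by gcongr; exact min_le_right _ _
      _ = δ / 2 := by field_simp
      _ < δ := NNReal.half_lt_self hδ.ne'
  -- With this choice `c r / 2 < s` reads `r < C s`. The half gives room for `γ(a+) ≤ γ(cr)`, which
  -- needs `a < cr`.
  set c := 2 / C with hc
  have hc0 : 0 < c := by positivity
  set ε := b / c with hε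
  have hε0 : 0 < ε := by positivity
  set r : ℝ → ℝ≥0 := fun t => Real.nnabs (t - τ) with hr
  have hrm : Measurable r := measurable_nnabs_sub
  -- At `τ` the integrand may be infinite, so an atom has to be excluded; since `λ(d) ≤ d`, the
  -- masses are `O(d²)`.
  have hnull : μ {τ} = 0 := by
    have h1 : Tendsto (fun d : ℝ≥0 => ((K * (d * d) : ℝ≥0) : ℝ≥0∞)) (𝓝[>] 0) (𝓝 0) := by
      have : ContinuousAt (fun d : ℝ≥0 => ((K * (d * d) : ℝ≥0) : ℝ≥0∞)) 0 := by
        apply ENNReal.continuous_coe.continuousAt.comp; fun_prop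
      simpa using this.tendsto.mono_left nhdsWithin_le_nhds
    refine le_antisymm (ge_of_tendsto h1 ?_) zero_le
    filter_upwards [hK, hlam.1.bound one_pos, self_mem_nhdsWithin] with d h2 h3 hd
    have h4 : lam d ≤ d := by
      rw [← NNReal.coe_le_coe]; simpa using h3
    refine (measure_mono ?_).trans (h2.trans (by gcongr))
    rw [singleton_subset_iff, ← nnabs_le_iff_mem_Icc]
    simp
  refine ⟨μ, hμ, c, hc0, Icc (τ - ε) (τ + ε), Icc_mem_nhds (by simpa using hε0) (by simpa using hε0), ?_⟩
  set T : Set (ℝ × ℝ≥0) := {p | c * r p.1 / 2 < p.2} with hT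
  have hTm : MeasurableSet T := measurableSet_lt (by fun_prop) (by fun_prop)
  have hk := measurable_invDensity hγ
  have hkm : Measurable (T.indicator fun p : ℝ × ℝ≥0 => (invDensity γ p.2 : ℝ≥0∞)) :=
    Measurable.indicator (by fun_prop) hTm
  have hpt : ∀ᵐ t ∂(μ.restrict (Icc (τ - ε) (τ + ε))), ((γ (c * r t) : ℝ≥0∞))⁻¹ ≤
      ((Function.rightLim γ b)⁻¹ : ℝ≥0) +
        ∫⁻ s in Ioc 0 b, T.indicator (fun p : ℝ × ℝ≥0 => (invDensity γ p.2 : ℝ≥0∞)) (t, s)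
          ∂(dMeasure hγ) := by
    rw [ae_restrict_iff' measurableSet_Icc]
    have h1 : ∀ᵐ t ∂μ, t ≠ τ := by
      rw [ae_iff]; simpa using hnull
    filter_upwards [h1] with t ht htI
    have hr0 : 0 < r t := by
      rw [pos_iff_ne_zero]
      intro h
      have : |t - τ| = 0 := by rw [← Real.coe_nnabs, show Real.nnabs (t - τ) = 0 from h]; rfl
      exact ht (by linarith [abs_eq_zero.1 this])
    have hrε : r t ≤ ε := nnabs_le_iff_mem_Icc.2 htI
    have ha : 0 < c * r t / 2 := by positivity
    have hab : c * r t / 2 < b := by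
      calc c * r t / 2 ≤ c * ε / 2 := by gcongr
        _ = b / 2 := by rw [hε]; field_simp
        _ < b := NNReal.half_lt_self hb0.ne'
    refine (inv_le_inv_rightLim_add hγ hpos ha (NNReal.half_lt_self (by positivity)) hab).trans ?_
    refine add_le_add le_rfl ?_
    rw [← lintegral_indicator measurableSet_Ioc, ← lintegral_indicator measurableSet_Ioc]
    apply lintegral_mono
    intro s
    by_cases hs : s ∈ Ioc (c * r t / 2) b
    · have h2 : s ∈ Ioc 0 b := ⟨ha.trans hs.1, hs.2⟩
      have h3 : (t, s) ∈ T := hs.1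
      beta_reduce
      rw [indicator_of_mem hs, indicator_of_mem h2, indicator_of_mem h3]
    · beta_reduce
      rw [indicator_of_notMem hs]
      exact zero_le
  calc ∫⁻ t in Icc (τ - ε) (τ + ε), ((γ (c * r t) : ℝ≥0∞))⁻¹ ∂μ
      ≤ ∫⁻ t in Icc (τ - ε) (τ + ε), (((Function.rightLim γ b)⁻¹ : ℝ≥0) +
        ∫⁻ s in Ioc 0 b, T.indicator (fun p : ℝ × ℝ≥0 => (invDensity γ p.2 : ℝ≥0∞)) (t, s)
          ∂(dMeasure hγ)) ∂μ := lintegral_mono_ae hpt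
    _ = ((Function.rightLim γ b)⁻¹ : ℝ≥0) * μ (Icc (τ - ε) (τ + ε)) +
        ∫⁻ s in Ioc 0 b, ∫⁻ t in Icc (τ - ε) (τ + ε),
          T.indicator (fun p : ℝ × ℝ≥0 => (invDensity γ p.2 : ℝ≥0∞)) (t, s) ∂μ ∂(dMeasure hγ) := by
        rw [lintegral_add_left measurable_const, setLIntegral_const,
          lintegral_lintegral_swap (f := fun t s =>
            T.indicator (fun p : ℝ × ℝ≥0 => (invDensity γ p.2 : ℝ≥0∞)) (t, s)) hkm.aemeasurable]
    _ ≤ ((Function.rightLim γ b)⁻¹ : ℝ≥0) * μ (Icc (τ - ε) (τ + ε)) +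
        ∫⁻ s in Ioc 0 b, (K * C : ℝ≥0) * ((s * lam (C * s) * invDensity γ s : ℝ≥0) : ℝ≥0∞)
          ∂(dMeasure hγ) := by
        refine add_le_add le_rfl ?_
        apply setLIntegral_mono' measurableSet_Ioc
        intro s hs
        calc ∫⁻ t in Icc (τ - ε) (τ + ε),
              T.indicator (fun p : ℝ × ℝ≥0 => (invDensity γ p.2 : ℝ≥0∞)) (t, s) ∂μ
            ≤ ∫⁻ t, (Icc (τ - (C * s : ℝ≥0)) (τ + (C * s : ℝ≥0))).indicator
                (fun _ => (invDensity γ s : ℝ≥0∞)) t ∂μ := by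
              refine (setLIntegral_le_lintegral _ _).trans (lintegral_mono fun t => ?_)
              by_cases h3 : (t, s) ∈ T
              · have h4 : t ∈ Icc (τ - (C * s : ℝ≥0)) (τ + (C * s : ℝ≥0)) := by
                  rw [← nnabs_le_iff_mem_Icc]
                  have h5 : c * r t / 2 < s := h3
                  have h6 : c * r t / 2 = r t / C := by rw [hc]; field_simp
                  rw [h6, div_lt_iff₀ hC, mul_comm] at h5
                  exact h5.le
                rw [indicator_of_mem h3, indicator_of_mem h4]
              · rw [indicator_of_notMem h3]; exact zero_le
          _ = invDensity γ s * μ (Icc (τ - (C * s : ℝ≥0)) (τ + (C * s : ℝ≥0))) :=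
              lintegral_indicator_const measurableSet_Icc _
          _ ≤ invDensity γ s * ((K * ((C * s) * lam (C * s)) : ℝ≥0) : ℝ≥0∞) := by
              gcongr
              have h7 : C * s < δ := (mul_le_mul_right hs.2 C).trans_lt hbδ
              exact hF _ (mul_pos hC hs.1) h7
          _ = _ := by
              push_cast
              ring
    _ < ∞ := by
        rw [lintegral_const_mul' _ _ ENNReal.coe_ne_top]
        refine ENNReal.add_lt_top.2 ⟨ENNReal.mul_lt_top ENNReal.coe_lt_top
          measure_Icc_lt_top, ENNReal.mul_lt_top ENNReal.coe_lt_top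
          (lt_of_le_of_lt (lintegral_mono_set ?_) hint)⟩
        exact fun s hs => ⟨zero_le, hs.2.trans_lt hb1⟩

end Regularity

/-! ### From regularity to mass bounds and an augury. -/

section Converse

variable {γ : ℝ≥0 → ℝ≥0} {lam : ℝ≥0 → ℝ≥0} {f : ℂ → ℂ} {A : ℝ≥0∞} {μ : Measure ℝ} {τ : ℝ}

theorem isLittleO_id_iff_tendsto_div :
    (fun t : ℝ≥0 => (lam t : ℝ)) =o[𝓝[>] 0] (fun t : ℝ≥0 => (t : ℝ)) ↔
      Tendsto (fun t => lam t / t) (𝓝[>] 0) (𝓝 0) := by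
  rw [isLittleO_iff_tendsto', ← NNReal.tendsto_coe]
  · simp
  · filter_upwards [self_mem_nhdsWithin] with t ht h
    exact absurd (NNReal.coe_eq_zero.1 h) (ne_of_gt ht)

theorem IsRegularAt.exists_setLIntegral_lt_top (h : IsRegularAt γ f τ)
    (hμ : IsNevanlinnaMeasure f μ) :
    ∃ c : ℝ≥0, 0 < c ∧ ∃ ε : ℝ≥0, 0 < ε ∧
      ∫⁻ t in Icc (τ - ε) (τ + ε), ((γ (c * Real.nnabs (t - τ)) : ℝ≥0∞))⁻¹ ∂μ < ∞ := by
  obtain ⟨ν, hν, c, hc, U, hU, hfin⟩ := h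
  rw [hν.unique hμ] at hfin
  obtain ⟨ε, hε, hsub⟩ := Metric.nhds_basis_closedBall.mem_iff.1 hU
  rw [Real.closedBall_eq_Icc] at hsub
  refine ⟨c, hc, ε.toNNReal, Real.toNNReal_pos.2 hε, ?_⟩
  rw [Real.coe_toNNReal _ hε.le]
  exact (lintegral_mono_set hsub).trans_lt hfin

/-- Markov's inequality for `1/γ(c|t - τ|)`. -/
theorem measure_Icc_le_mul_setLIntegral (hγ : Monotone γ) (hpos : ∀ t, 0 < t → 0 < γ t)
    {c d : ℝ≥0} (hc : 0 < c) (hd : 0 < d) :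
    μ (Icc (τ - d) (τ + d)) ≤ γ (c * d) *
      ∫⁻ t in Icc (τ - d) (τ + d), ((γ (c * Real.nnabs (t - τ)) : ℝ≥0∞))⁻¹ ∂μ := by
  have h0 : (γ (c * d) : ℝ≥0∞) ≠ 0 := by
    simpa using (hpos (c * d) (by positivity)).ne'
  calc μ (Icc (τ - d) (τ + d))
      = γ (c * d) * ∫⁻ t in Icc (τ - d) (τ + d), ((γ (c * d) : ℝ≥0∞))⁻¹ ∂μ := by
        rw [setLIntegral_const, ← mul_assoc, ENNReal.mul_inv_cancel h0 ENNReal.coe_ne_top, one_mul]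
    _ ≤ _ := by
        gcongr 1
        apply setLIntegral_mono' measurableSet_Icc
        intro t ht
        have := nnabs_le_iff_mem_Icc.2 ht
        gcongr
        exact hγ (by gcongr)

/-- Near `τ` the integrand is `O(1/γ)` because `γ(t) = O(t²)`; away from `τ` it is comparable to
`1/(1 + t²)`. -/
theorem HasPoissonRepresentation.lintegral_inv_sq_ne_top (h : HasPoissonRepresentation f A μ)
    (hγ : Monotone γ)
    (hO : (fun t : ℝ≥0 => (γ t : ℝ)) =O[𝓝[>] 0] (fun t : ℝ≥0 => (t : ℝ) ^ 2))
    {c ε : ℝ≥0} (hc : 0 < c) (hε : 0 < ε)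
    (hreg : ∫⁻ t in Icc (τ - ε) (τ + ε), ((γ (c * Real.nnabs (t - τ)) : ℝ≥0∞))⁻¹ ∂μ < ∞) :
    ∫⁻ t, ((Real.nnabs (t - τ) : ℝ≥0∞) ^ 2)⁻¹ ∂μ ≠ ∞ := by
  obtain ⟨K, hK, δ, hδ, hle⟩ := exists_le_mul_sq hO
  have hγ0 := map_zero_of_isBigO hγ hO
  set ρ : ℝ≥0 := min ε (δ / (2 * c)) with hρ
  have hρ0 : 0 < ρ := lt_min hε (by positivity)
  have hcρ : c * ρ < δ := by
    calc c * ρ ≤ c * (δ / (2 * c)) := by gcongr; exact min_le_right _ _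
      _ = δ / 2 := by field_simp
      _ < δ := NNReal.half_lt_self hδ.ne'
  rw [← lintegral_add_compl _ (measurableSet_Icc (a := τ - ρ) (b := τ + ρ))]
  refine (ENNReal.add_lt_top.2 ⟨?_, ?_⟩).ne
  · have hρε : (ρ : ℝ) ≤ ε := NNReal.coe_le_coe.2 (min_le_left _ _)
    calc ∫⁻ t in Icc (τ - ρ) (τ + ρ), ((Real.nnabs (t - τ) : ℝ≥0∞) ^ 2)⁻¹ ∂μ
        ≤ ∫⁻ t in Icc (τ - ρ) (τ + ρ), (K * c ^ 2 : ℝ≥0) *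
            ((γ (c * Real.nnabs (t - τ)) : ℝ≥0∞))⁻¹ ∂μ := by
          apply setLIntegral_mono' measurableSet_Icc
          intro t ht
          have htρ := nnabs_le_iff_mem_Icc.2 ht
          have hKc : ((K * c ^ 2 : ℝ≥0) : ℝ≥0∞) ≠ 0 := by
            have : K * c ^ 2 ≠ 0 := by positivity
            exact_mod_cast this
          rcases eq_or_ne (Real.nnabs (t - τ)) 0 with h0 | h0
          · rw [h0, mul_zero, hγ0, ENNReal.coe_zero, ENNReal.inv_zero, ENNReal.mul_top hKc]
            exact le_top
          · have h1 : γ (c * Real.nnabs (t - τ)) ≤ (K * c ^ 2) * Real.nnabs (t - τ) ^ 2 := by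
              have h2 : 0 < c * Real.nnabs (t - τ) := by positivity
              calc _ ≤ K * (c * Real.nnabs (t - τ)) ^ 2 :=
                    hle _ h2 ((mul_le_mul_right htρ c).trans_lt hcρ)
                _ = _ := by ring
            calc ((Real.nnabs (t - τ) : ℝ≥0∞) ^ 2)⁻¹ = (K * c ^ 2 : ℝ≥0) *
                  (((K * c ^ 2) * Real.nnabs (t - τ) ^ 2 : ℝ≥0) : ℝ≥0∞)⁻¹ := by
                  rw [ENNReal.coe_mul (K * c ^ 2), ENNReal.mul_inv (Or.inl hKc) (Or.inl ENNReal.coe_ne_top),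
                    ← mul_assoc, ENNReal.mul_inv_cancel hKc ENNReal.coe_ne_top, one_mul,
                    ENNReal.coe_pow]
              _ ≤ _ := by gcongr
      _ ≤ (K * c ^ 2 : ℝ≥0) * ∫⁻ t in Icc (τ - ε) (τ + ε),
            ((γ (c * Real.nnabs (t - τ)) : ℝ≥0∞))⁻¹ ∂μ := by
          rw [lintegral_const_mul' _ _ ENNReal.coe_ne_top]
          gcongr
      _ < ∞ := ENNReal.mul_lt_top ENNReal.coe_lt_top hreg
  · calc ∫⁻ t in (Icc (τ - ρ) (τ + ρ))ᶜ, ((Real.nnabs (t - τ) : ℝ≥0∞) ^ 2)⁻¹ ∂μ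
        ≤ ∫⁻ t in (Icc (τ - ρ) (τ + ρ))ᶜ, ENNReal.ofReal (2 + (1 + 2 * τ ^ 2) / ρ ^ 2) *
            ENNReal.ofReal (1 + t ^ 2)⁻¹ ∂μ := by
          apply setLIntegral_mono' measurableSet_Icc.compl
          intro t ht
          have h1 : ρ < Real.nnabs (t - τ) := by
            rw [← not_le, nnabs_le_iff_mem_Icc]; exact ht
          have h2 : (ρ : ℝ) < |t - τ| := by
            rw [← Real.coe_nnabs]; exact h1
          have hρ' : (0 : ℝ) < ρ := hρ0
          have h3 : (ρ : ℝ) ^ 2 ≤ (t - τ) ^ 2 := by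
            rw [← sq_abs (t - τ)]
            gcongr
          have h4 : 0 < (t - τ) ^ 2 := lt_of_lt_of_le (by positivity) h3
          have h5 : (((Real.nnabs (t - τ) : ℝ≥0∞) ^ 2)⁻¹) = ENNReal.ofReal (((t - τ) ^ 2)⁻¹) := by
            rw [ENNReal.ofReal_inv_of_pos h4, ← sq_abs, ENNReal.ofReal_pow (abs_nonneg _)]
            congr 2
            rw [← Real.coe_nnabs, ENNReal.ofReal_coe_nnreal]
          rw [h5, ← ENNReal.ofReal_mul (by positivity)]
          apply ENNReal.ofReal_le_ofReal
          rw [le_mul_inv_iff₀ (by positivity), inv_mul_le_iff₀ h4]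
          have h6 : 1 + 2 * τ ^ 2 ≤ (t - τ) ^ 2 * ((1 + 2 * τ ^ 2) / ρ ^ 2) := by
            calc 1 + 2 * τ ^ 2 = ρ ^ 2 * ((1 + 2 * τ ^ 2) / ρ ^ 2) := by field_simp
              _ ≤ _ := by gcongr
          -- The underlying inequality is `1 + t² ≤ 2 (t - τ)² + 1 + 2τ²`.
          nlinarith [sq_nonneg (t - 2 * τ)]
      _ ≤ ENNReal.ofReal (2 + (1 + 2 * τ ^ 2) / ρ ^ 2) * ∫⁻ t, ENNReal.ofReal (1 + t ^ 2)⁻¹ ∂μ := by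
          rw [lintegral_const_mul' _ _ ENNReal.ofReal_ne_top]
          gcongr
          exact Measure.restrict_le_self
      _ < ∞ := ENNReal.mul_lt_top ENNReal.ofReal_lt_top (lintegral_inv_one_add_sq_lt_top h)

/-- Markov's inequality gives `O(d²)`; the improvement to `o(d²)` comes from the integral `G d` of
`1/γ` over the shrinking interval tending to `0`. It is what makes `m(2d)/d` an `o(d)`, with `m` the
interval mass. -/
theorem tendsto_div_sq_of_setLIntegral_lt_top [IsLocallyFiniteMeasure μ]
    (hγ : Monotone γ) (hpos : ∀ t, 0 < t → 0 < γ t)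
    (hO : (fun t : ℝ≥0 => (γ t : ℝ)) =O[𝓝[>] 0] (fun t : ℝ≥0 => (t : ℝ) ^ 2))
    {c ε : ℝ≥0} (hc : 0 < c) (hε : 0 < ε)
    (hreg : ∫⁻ t in Icc (τ - ε) (τ + ε), ((γ (c * Real.nnabs (t - τ)) : ℝ≥0∞))⁻¹ ∂μ < ∞) :
    Tendsto (fun d : ℝ≥0 => (μ (Icc (τ - d) (τ + d))).toNNReal / d ^ 2) (𝓝[>] 0) (𝓝 0) := by
  obtain ⟨K, hK, δ, hδ, hle⟩ := exists_le_mul_sq hO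
  set G : ℝ≥0 → ℝ≥0∞ := fun d =>
    ∫⁻ t in Icc (τ - d) (τ + d), ((γ (c * Real.nnabs (t - τ)) : ℝ≥0∞))⁻¹ ∂μ with hG
  have hle' : ∀ᶠ d in 𝓝[>] (0 : ℝ≥0), γ (c * d) ≤ K * c ^ 2 * d ^ 2 := by
    rw [eventually_nhdsGT_zero_iff]
    refine ⟨δ / c, by positivity, fun d h1 h2 => ?_⟩
    rw [lt_div_iff₀ hc, mul_comm] at h2
    exact (hle _ (by positivity) h2).trans_eq (by ring)
  have hev : ∀ᶠ d in 𝓝[>] (0 : ℝ≥0), d ≤ ε := by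
    rw [eventually_nhdsGT_zero_iff]
    exact ⟨ε, hε, fun d _ h => h.le⟩
  have hsub : ∀ d ≤ ε, Icc (τ - d) (τ + d) ⊆ Icc (τ - ε) (τ + ε) := fun d hd => by
    have : (d : ℝ) ≤ ε := hd
    exact Icc_subset_Icc (by linarith) (by linarith)
  have hGmono : ∀ d ≤ ε, G d ≤ G ε := fun d hd => lintegral_mono_set (hsub d hd)
  have hm : Tendsto (fun d : ℝ≥0 => μ (Icc (τ - d) (τ + d))) (𝓝[>] 0) (𝓝 0) := by
    have h1 : Tendsto (fun d : ℝ≥0 => ((K * c ^ 2 * d ^ 2 : ℝ≥0) : ℝ≥0∞) * G ε) (𝓝[>] 0) (𝓝 0) := by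
      have h2 : Tendsto (fun d : ℝ≥0 => ((K * c ^ 2 * d ^ 2 : ℝ≥0) : ℝ≥0∞)) (𝓝[>] 0) (𝓝 0) := by
        have : ContinuousAt (fun d : ℝ≥0 => ((K * c ^ 2 * d ^ 2 : ℝ≥0) : ℝ≥0∞)) 0 := by
          apply ENNReal.continuous_coe.continuousAt.comp; fun_prop
        simpa using this.tendsto.mono_left nhdsWithin_le_nhds
      simpa using ENNReal.Tendsto.mul_const h2 (Or.inr hreg.ne)
    refine tendsto_of_tendsto_of_tendsto_of_le_of_le' tendsto_const_nhds h1
      (Eventually.of_forall fun _ => zero_le) ?_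
    filter_upwards [hle', hev, self_mem_nhdsWithin] with d h2 h3 hd
    refine (measure_Icc_le_mul_setLIntegral hγ hpos hc hd).trans ?_
    gcongr
    exact hGmono d h3
  have hGlim : Tendsto G (𝓝[>] 0) (𝓝 0) := by
    have h1 := tendsto_setLIntegral_zero (μ := μ.restrict (Icc (τ - ε) (τ + ε)))
      (s := fun d : ℝ≥0 => Icc (τ - d) (τ + d)) (l := 𝓝[>] 0) hreg.ne
      (tendsto_of_tendsto_of_tendsto_of_le_of_le tendsto_const_nhds hm (fun _ => zero_le)
        fun d => Measure.restrict_apply_le _ _)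
    refine h1.congr' ?_
    filter_upwards [hev] with d hd
    rw [Measure.restrict_restrict measurableSet_Icc, inter_eq_left.2 (hsub d hd)]
  have h1 : Tendsto (fun d => K * c ^ 2 * (G d).toNNReal) (𝓝[>] 0) (𝓝 0) := by
    simpa using ((ENNReal.tendsto_toNNReal ENNReal.zero_ne_top).comp hGlim).const_mul (K * c ^ 2)
  refine tendsto_of_tendsto_of_tendsto_of_le_of_le' tendsto_const_nhds h1
    (Eventually.of_forall fun _ => zero_le) ?_
  filter_upwards [hle', hev, self_mem_nhdsWithin] with d h2 h3 hd
  have hd0 : 0 < d := hd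
  have hGd : G d ≠ ∞ := ((hGmono d h3).trans_lt hreg).ne
  rw [div_le_iff₀ (by positivity), ← ENNReal.coe_le_coe,
    ENNReal.coe_toNNReal measure_Icc_lt_top.ne]
  refine (measure_Icc_le_mul_setLIntegral hγ hpos hc hd).trans ?_
  push_cast
  rw [ENNReal.coe_toNNReal hGd, mul_right_comm]
  gcongr
  exact_mod_cast h2

/-- The integral of the measure of intervals against `-d(1/γ)` is controlled by the integral of
`1/γ`. -/
theorem setLIntegral_measure_mul_invDensity_lt_top [IsLocallyFiniteMeasure μ]
    (hγ : Monotone γ) (hpos : ∀ t, 0 < t → 0 < γ t) (hγ0 : γ 0 = 0) {c ε : ℝ≥0}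
    (hreg : ∫⁻ t in Icc (τ - ε) (τ + ε), ((γ (c * Real.nnabs (t - τ)) : ℝ≥0∞))⁻¹ ∂μ < ∞)
    {a : ℝ≥0} (ha : 0 < a) (haε : a ≤ ε) (hac : 2 * a * c ≤ 1) :
    ∫⁻ s in Ioo 0 1, μ (Icc (τ - (a * s : ℝ≥0)) (τ + (a * s : ℝ≥0))) * invDensity γ s
      ∂(dMeasure hγ) < ∞ := by
  set r : ℝ → ℝ≥0 := fun t => Real.nnabs (t - τ) with hr
  have hrm : Measurable r := measurable_nnabs_sub
  set T : Set (ℝ × ℝ≥0) := {p | r p.1 ≤ a * p.2} with hT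
  have hTm : MeasurableSet T := measurableSet_le (by fun_prop) (by fun_prop)
  have hk := measurable_invDensity hγ
  have hkm : Measurable (T.indicator fun p : ℝ × ℝ≥0 => (invDensity γ p.2 : ℝ≥0∞)) :=
    Measurable.indicator (by fun_prop) hTm
  refine lt_of_le_of_lt ?_ hreg
  calc ∫⁻ s in Ioo 0 1, μ (Icc (τ - (a * s : ℝ≥0)) (τ + (a * s : ℝ≥0))) * invDensity γ s
        ∂(dMeasure hγ)
      = ∫⁻ s in Ioo 0 1, ∫⁻ t, T.indicator (fun p : ℝ × ℝ≥0 => (invDensity γ p.2 : ℝ≥0∞)) (t, s) ∂μ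
        ∂(dMeasure hγ) := by
        congr 1 with s
        rw [mul_comm, ← lintegral_indicator_const measurableSet_Icc]
        congr 1 with t
        by_cases h : (t, s) ∈ T
        · have h' : t ∈ Icc (τ - (a * s : ℝ≥0)) (τ + (a * s : ℝ≥0)) := nnabs_le_iff_mem_Icc.1 h
          rw [indicator_of_mem h, indicator_of_mem h']
        · have h' : t ∉ Icc (τ - (a * s : ℝ≥0)) (τ + (a * s : ℝ≥0)) := fun h1 =>
            h (nnabs_le_iff_mem_Icc.2 h1)
          rw [indicator_of_notMem h, indicator_of_notMem h']
    _ = ∫⁻ t, ∫⁻ s in Ioo 0 1, T.indicator (fun p : ℝ × ℝ≥0 => (invDensity γ p.2 : ℝ≥0∞)) (t, s)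
        ∂(dMeasure hγ) ∂μ := (lintegral_lintegral_swap (f := fun t s =>
            T.indicator (fun p : ℝ × ℝ≥0 => (invDensity γ p.2 : ℝ≥0∞)) (t, s))
              hkm.aemeasurable).symm
    _ ≤ ∫⁻ t, (Icc (τ - ε) (τ + ε)).indicator (fun t => ((γ (c * r t) : ℝ≥0∞))⁻¹) t ∂μ := by
        apply lintegral_mono
        intro t
        beta_reduce
        by_cases ht : r t ≤ a
        · rw [indicator_of_mem (nnabs_le_iff_mem_Icc.1 (ht.trans haε))]
          rcases eq_or_ne (r t) 0 with h0 | h0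
          · rw [h0, mul_zero, hγ0, ENNReal.coe_zero, ENNReal.inv_zero]
            exact le_top
          · have hr0 : 0 < r t := pos_iff_ne_zero.2 h0
            -- Only `s ≥ r/a > q` contribute, so the inner integral is at most `1/γ(q+)`. The
            -- condition `2ac ≤ 1` gives `c r ≤ q`, hence the bound `1/γ(cr)`.
            set q := r t / (2 * a) with hq
            have hq0 : 0 < q := by positivity
            have hq1 : q < 1 := by
              rw [hq, div_lt_one (by positivity)]
              calc r t ≤ a := ht
                _ < 2 * a := lt_mul_of_one_lt_left ha one_lt_two
            calc ∫⁻ s in Ioo 0 1, T.indicator (fun p : ℝ × ℝ≥0 => (invDensity γ p.2 : ℝ≥0∞)) (t, s)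
                  ∂(dMeasure hγ) ≤ ∫⁻ s in Ioc q 1, invDensity γ s ∂(dMeasure hγ) := by
                  rw [← lintegral_indicator measurableSet_Ioo, ← lintegral_indicator measurableSet_Ioc]
                  apply lintegral_mono
                  intro s
                  beta_reduce
                  by_cases h1 : s ∈ Ioo 0 1
                  · rw [indicator_of_mem h1]
                    by_cases h2 : (t, s) ∈ T
                    · have h3 : r t ≤ a * s := h2
                      have h4 : s ∈ Ioc q 1 := by
                        refine ⟨?_, h1.2.le⟩
                        rw [hq, div_lt_iff₀ (by positivity)]
                        calc r t ≤ a * s := h3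
                          _ < 2 * (a * s) := lt_mul_of_one_lt_left (mul_pos ha h1.1) one_lt_two
                          _ = s * (2 * a) := by ring
                      rw [indicator_of_mem h2, indicator_of_mem h4]
                    · rw [indicator_of_notMem h2]; exact zero_le
                  · rw [indicator_of_notMem h1]; exact zero_le
              _ ≤ ((Function.rightLim γ q)⁻¹ : ℝ≥0) := by
                  rw [← lintegral_invDensity_Ioc hγ hpos hq0 hq1]
                  exact le_add_self
              _ ≤ _ := by
                  rw [ENNReal.coe_inv (rightLim_pos hγ hpos hq0).ne']
                  gcongr
                  refine hγ.le_rightLim ?_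
                  rw [hq, le_div_iff₀ (by positivity)]
                  calc c * r t * (2 * a) = (2 * a * c) * r t := by ring
                    _ ≤ 1 * r t := by gcongr
                    _ = r t := one_mul _
        · have : ∀ s ∈ Ioo (0 : ℝ≥0) 1,
              T.indicator (fun p : ℝ × ℝ≥0 => (invDensity γ p.2 : ℝ≥0∞)) (t, s) = 0 := by
            intro s hs
            apply indicator_of_notMem
            intro h
            have h3 : r t ≤ a * s := h
            exact ht (h3.trans (mul_le_of_le_one_right zero_le hs.2.le))
          rw [setLIntegral_congr_fun measurableSet_Ioo this, lintegral_zero]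
          exact zero_le
    _ = _ := lintegral_indicator measurableSet_Icc _

theorem exists_isAugury_of_setLIntegral_lt_top [IsLocallyFiniteMeasure μ]
    (hγ : Monotone γ) (hpos : ∀ t, 0 < t → 0 < γ t)
    (hO : (fun t : ℝ≥0 => (γ t : ℝ)) =O[𝓝[>] 0] (fun t : ℝ≥0 => (t : ℝ) ^ 2))
    {c ε : ℝ≥0} (hc : 0 < c) (hε : 0 < ε)
    (hreg : ∫⁻ t in Icc (τ - ε) (τ + ε), ((γ (c * Real.nnabs (t - τ)) : ℝ≥0∞))⁻¹ ∂μ < ∞) :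
    ∃ lam, IsAugury hγ lam ∧ ∀ d : ℝ≥0, 0 < d → 0 < lam d ∧
      μ (Icc (τ - 2 * d) (τ + 2 * d)) ≤ (d * lam d : ℝ≥0) := by
  set F : ℝ≥0 → ℝ≥0 := fun d => (μ (Icc (τ - d) (τ + d))).toNNReal with hF
  have hFcoe : ∀ d, (F d : ℝ≥0∞) = μ (Icc (τ - d) (τ + d)) := fun d =>
    ENNReal.coe_toNNReal measure_Icc_lt_top.ne
  have hFmono : Monotone F := by
    intro a b hab
    have : (a : ℝ) ≤ b := hab
    rw [← ENNReal.coe_le_coe, hFcoe, hFcoe]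
    exact measure_mono (Icc_subset_Icc (by linarith) (by linarith))
  have hγ0 := map_zero_of_isBigO hγ hO
  have hFm := hFmono.measurable
  have hγm := hγ.measurable
  -- `C ≤ 1/2` makes `C t < t`; the other two bounds allow `a = 2C` in
  -- `setLIntegral_measure_mul_invDensity_lt_top`.
  set C : ℝ≥0 := min (1 / 2) (min (1 / (4 * c)) (ε / 2)) with hC
  have hC0 : 0 < C := by
    rw [hC]
    exact lt_min (by positivity) (lt_min (by positivity) (by positivity))
  have hC1 : C ≤ 1 / 2 := min_le_left _ _
  have hC2 : C ≤ 1 / (4 * c) := (min_le_right _ _).trans (min_le_left _ _)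
  have hC3 : C ≤ ε / 2 := (min_le_right _ _).trans (min_le_right _ _)
  -- The term `γ d ^ 2` only secures positivity of `λ`. It is cheap, because `γ(Ct)² ≤ γ(t-) γ(t+)`
  -- bounds its share of the augury integral by the `dγ`-mass of `[0, 1)`.
  refine ⟨fun d => F (2 * d) / d + γ d ^ 2, isAugury_of_lintegral_lt_top hγ (by fun_prop) ?_ hC0 ?_,
    fun d hd => ⟨?_, ?_⟩⟩
  · rw [isLittleO_id_iff_tendsto_div]
    obtain ⟨K, hK, δ, hδ, hle⟩ := exists_le_mul_sq hO
    have h1 := tendsto_div_sq_of_setLIntegral_lt_top hγ hpos hO hc hε hreg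
    have h2 : Tendsto (fun d : ℝ≥0 => 2 * d) (𝓝[>] 0) (𝓝[>] 0) := by
      refine tendsto_nhdsWithin_iff.2 ⟨?_, ?_⟩
      · have : ContinuousAt (fun d : ℝ≥0 => 2 * d) 0 := by fun_prop
        simpa using this.tendsto.mono_left nhdsWithin_le_nhds
      · filter_upwards [self_mem_nhdsWithin] with d hd
        exact mul_pos (a := (2 : ℝ≥0)) two_pos (mem_Ioi.1 hd)
    have h3 : Tendsto (fun d : ℝ≥0 => 4 * (F (2 * d) / (2 * d) ^ 2) + K ^ 2 * d ^ 3) (𝓝[>] 0)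
        (𝓝 0) := by
      have h4 : ContinuousAt (fun d : ℝ≥0 => K ^ 2 * d ^ 3) 0 := by fun_prop
      have h5 : Tendsto (fun d : ℝ≥0 => K ^ 2 * d ^ 3) (𝓝[>] 0) (𝓝 0) := by
        simpa using h4.tendsto.mono_left nhdsWithin_le_nhds
      have h6 : Tendsto (fun d : ℝ≥0 => F (2 * d) / (2 * d) ^ 2) (𝓝[>] 0) (𝓝 0) := h1.comp h2
      simpa using (h6.const_mul 4).add h5
    refine tendsto_of_tendsto_of_tendsto_of_le_of_le' tendsto_const_nhds h3
      (Eventually.of_forall fun _ => zero_le) ?_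
    rw [eventually_nhdsGT_zero_iff]
    refine ⟨δ, hδ, fun d hd0 hd => ?_⟩
    rw [add_div]
    gcongr
    · apply le_of_eq
      field_simp
      ring
    · rw [div_le_iff₀ hd0]
      calc γ d ^ 2 ≤ (K * d ^ 2) ^ 2 := by gcongr; exact hle d hd0 hd
        _ = _ := by ring
  · have hsplit : ∫⁻ t in Ioo 0 1, (μ (Icc (τ - (2 * C * t : ℝ≥0)) (τ + (2 * C * t : ℝ≥0))) *
        invDensity γ t) ∂(dMeasure hγ) < ∞ := by
      apply setLIntegral_measure_mul_invDensity_lt_top hγ hpos hγ0 hreg (by positivity)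
      · calc 2 * C ≤ 2 * (ε / 2) := by gcongr
          _ = ε := by field_simp
      · calc 2 * (2 * C) * c ≤ 2 * (2 * (1 / (4 * c))) * c := by gcongr
          _ = 1 := by field_simp; norm_num
    calc ∫⁻ t in Ico 0 1, ((t * (F (2 * (C * t)) / (C * t) + γ (C * t) ^ 2) * invDensity γ t : ℝ≥0) :
          ℝ≥0∞) ∂(dMeasure hγ)
        ≤ ∫⁻ t in Ico 0 1, ((Ioo 0 1).indicator (fun t : ℝ≥0 => ((C⁻¹ : ℝ≥0) : ℝ≥0∞) *
            (μ (Icc (τ - (2 * C * t : ℝ≥0)) (τ + (2 * C * t : ℝ≥0))) * invDensity γ t)) t + 1)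
              ∂(dMeasure hγ) := by
          apply setLIntegral_mono' measurableSet_Ico
          intro t ht
          rcases eq_or_ne t 0 with rfl | h0
          · simp
          · have ht0 : 0 < t := pos_iff_ne_zero.2 h0
            rw [indicator_of_mem (show t ∈ Ioo 0 1 from ⟨ht0, ht.2⟩), ← hFcoe]
            norm_cast
            have hCt : C * t < t := by
              calc C * t ≤ 1 / 2 * t := by gcongr
                _ < t := by
                  rw [one_div, inv_mul_eq_div]; exact NNReal.half_lt_self h0
            have hl := hγ.le_leftLim hCt
            have hl0 := leftLim_pos hγ hpos ht0
            have hr0 := rightLim_pos hγ hpos ht0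
            have hlr := hγ.leftLim_le_rightLim (le_refl t)
            calc t * (F (2 * (C * t)) / (C * t) + γ (C * t) ^ 2) * invDensity γ t
                = C⁻¹ * (F (2 * C * t) * invDensity γ t) + t * (γ (C * t) ^ 2 * invDensity γ t) := by
                  rw [← mul_assoc 2 C t]
                  field_simp
              _ ≤ C⁻¹ * (F (2 * C * t) * invDensity γ t) + 1 * 1 := by
                  gcongr
                  · exact ht.2.le
                  · rw [invDensity, ← div_eq_mul_inv, div_le_one (by positivity), sq]
                    exact mul_le_mul' hl (hl.trans hlr)
              _ = _ := by rw [one_mul]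
      _ = ((C⁻¹ : ℝ≥0) : ℝ≥0∞) * ∫⁻ t in Ioo 0 1,
            (μ (Icc (τ - (2 * C * t : ℝ≥0)) (τ + (2 * C * t : ℝ≥0))) * invDensity γ t)
              ∂(dMeasure hγ) + dMeasure hγ (Ico 0 1) := by
          rw [lintegral_add_right _ measurable_const, setLIntegral_const, one_mul,
            lintegral_indicator measurableSet_Ioo, Measure.restrict_restrict measurableSet_Ioo,
            inter_eq_left.2 Ioo_subset_Ico_self, lintegral_const_mul' _ _ ENNReal.coe_ne_top]
      _ < ∞ := ENNReal.add_lt_top.2 ⟨ENNReal.mul_lt_top ENNReal.coe_lt_top hsplit,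
          (measure_mono Ico_subset_Icc_self).trans_lt measure_Icc_lt_top⟩
  · have := hpos d hd
    positivity
  · have h1 := hFcoe (2 * d)
    push_cast at h1
    rw [← h1]
    norm_cast
    rw [mul_add, mul_div_cancel₀ _ hd.ne']
    exact le_self_add

end Converse

/-! ### Closure properties of auguries and the consequences of `√γ` being one. -/

section Augury

variable {γ : ℝ≥0 → ℝ≥0} {lam : ℝ≥0 → ℝ≥0}

theorem tendsto_const_mul_nhdsGT_zero {C : ℝ≥0} (hC : 0 < C) :
    Tendsto (fun t : ℝ≥0 => C * t) (𝓝[>] 0) (𝓝[>] 0) := by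
  refine tendsto_nhdsWithin_iff.2 ⟨?_, ?_⟩
  · have : ContinuousAt (fun d : ℝ≥0 => C * d) 0 := by fun_prop
    simpa using this.tendsto.mono_left nhdsWithin_le_nhds
  · filter_upwards [self_mem_nhdsWithin] with d hd
    exact mul_pos hC (mem_Ioi.1 hd)

/-- The free dilation constant in the definition absorbs the inner factor: `C₀` is replaced by `C₀ /
C`. -/
theorem IsAugury.const_mul_comp {hγ : Monotone γ} (h : IsAugury hγ lam) (hlam : Measurable lam)
    {C : ℝ≥0} (hC : 0 < C) (D : ℝ≥0) : IsAugury hγ fun t => D * lam (C * t) := by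
  obtain ⟨C₀, hC₀, hint⟩ := h.exists_lintegral_lt_top
  refine isAugury_of_lintegral_lt_top hγ (by fun_prop) ?_ (C := C₀ / C) (by positivity) ?_
  · rw [isLittleO_id_iff_tendsto_div]
    have h1 := ((isLittleO_id_iff_tendsto_div.1 h.1).comp
      (tendsto_const_mul_nhdsGT_zero hC)).const_mul (D * C)
    rw [mul_zero] at h1
    refine h1.congr fun t => ?_
    rw [Function.comp_apply]
    field_simp
  · have h1 : ∀ t : ℝ≥0, ((t * (D * lam (C * (C₀ / C * t))) * invDensity γ t : ℝ≥0) : ℝ≥0∞) =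
        D * ((t * lam (C₀ * t) * invDensity γ t : ℝ≥0) : ℝ≥0∞) := by
      intro t
      have h2 : C * (C₀ / C * t) = C₀ * t := by field_simp
      rw [h2]
      push_cast
      ring
    simp_rw [h1]
    rw [lintegral_const_mul' _ _ ENNReal.coe_ne_top]
    exact ENNReal.mul_lt_top ENNReal.coe_lt_top hint

/-- `γ = √γ · √γ`, where one factor is bounded in the integral and `γ/t = (√γ/t)² t → 0`. This makes
the curve of height `γ` admissible. -/
theorem isAugury_self_of_sqrt {hγ : Monotone γ}
    (h : IsAugury hγ fun t => NNReal.sqrt (γ t)) : IsAugury hγ γ := by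
  obtain ⟨C, hC, hint⟩ := h.exists_lintegral_lt_top
  refine isAugury_of_lintegral_lt_top hγ hγ.measurable ?_ hC ?_
  · rw [isLittleO_id_iff_tendsto_div]
    have h1 := isLittleO_id_iff_tendsto_div.1 h.1
    have h2 : Tendsto (fun t : ℝ≥0 => t) (𝓝[>] 0) (𝓝 0) := nhdsWithin_le_nhds
    have h3 := (h1.mul h1).mul h2
    rw [mul_zero] at h3
    refine h3.congr' ?_
    filter_upwards [self_mem_nhdsWithin] with t ht
    have : t ≠ 0 := ne_of_gt ht
    rw [div_mul_div_comm, NNReal.mul_self_sqrt]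
    field_simp
  · calc ∫⁻ t in Ico 0 1, ((t * γ (C * t) * invDensity γ t : ℝ≥0) : ℝ≥0∞) ∂(dMeasure hγ)
        ≤ ∫⁻ t in Ico 0 1, (NNReal.sqrt (γ C) : ℝ≥0∞) *
            ((t * NNReal.sqrt (γ (C * t)) * invDensity γ t : ℝ≥0) : ℝ≥0∞) ∂(dMeasure hγ) := by
          apply setLIntegral_mono' measurableSet_Ico
          intro t ht
          norm_cast
          have h1 : γ (C * t) ≤ NNReal.sqrt (γ C) * NNReal.sqrt (γ (C * t)) := by
            conv_lhs => rw [← NNReal.mul_self_sqrt (γ (C * t))]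
            gcongr
            exact hγ (mul_le_of_le_one_right zero_le ht.2.le)
          calc t * γ (C * t) * invDensity γ t
              ≤ t * (NNReal.sqrt (γ C) * NNReal.sqrt (γ (C * t))) * invDensity γ t := by gcongr
            _ = _ := by ring
      _ < ∞ := by
          rw [lintegral_const_mul' _ _ ENNReal.coe_ne_top]
          exact ENNReal.mul_lt_top ENNReal.coe_lt_top hint

theorem exists_sq_mul_le_of_isAugury_sqrt {hγ : Monotone γ} (hpos : ∀ t, 0 < t → 0 < γ t)
    (h : IsAugury hγ fun t => NNReal.sqrt (γ t)) :
    ∃ a K : ℝ≥0, 0 < a ∧ a < 1 ∧ 0 < K ∧ ∀ s, 0 < s → s < 1 → s ^ 2 * γ (a * s) ≤ K * γ s ^ 2 := by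
  obtain ⟨C₀, hC₀, hint⟩ := h.exists_lintegral_lt_top
  set C := min C₀ 1 with hC
  have hC0 : 0 < C := lt_min hC₀ one_pos
  set b : ℝ≥0 := 1 / 2 with hb
  have hb0 : 0 < b := by positivity
  have hb1 : b < 1 := by rw [← NNReal.coe_lt_coe]; norm_num [hb]
  set J := ∫⁻ t in Ico 0 1, ((t * NNReal.sqrt (γ (C₀ * t)) * invDensity γ t : ℝ≥0) : ℝ≥0∞)
      ∂(dMeasure hγ) with hJ
  set K : ℝ≥0 := NNReal.sqrt (γ 1) * (Function.rightLim γ b)⁻¹ + J.toNNReal with hK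
  -- `s √γ(Cs)` increases with `s`, so it can be moved inside `∫ d(-1/γ)` over `(s, b]` and bounded
  -- by the augury integral `J`. Thus `s √γ(Cs) / γ(s+)` is bounded.
  have hmain : ∀ s, 0 < s → s < b → s * NNReal.sqrt (γ (C * s)) ≤ K * γ (2 * s) := by
    intro s hs hsb
    have hR := rightLim_pos hγ hpos hs
    have h1 : ((s * NNReal.sqrt (γ (C * s)) : ℝ≥0) : ℝ≥0∞) *
        ((Function.rightLim γ s)⁻¹ : ℝ≥0) ≤ K := by
      rw [← lintegral_invDensity_Ioc hγ hpos hs hsb, mul_add, hK, ENNReal.coe_add,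
        ENNReal.coe_toNNReal hint.ne]
      refine add_le_add ?_ ?_
      · norm_cast
        gcongr
        calc s * NNReal.sqrt (γ (C * s)) ≤ 1 * NNReal.sqrt (γ 1) := by
              gcongr
              · exact (hsb.trans hb1).le
              · apply hγ
                exact mul_le_one' (min_le_right _ _) (hsb.trans hb1).le
          _ = _ := one_mul _
      · rw [← lintegral_const_mul' _ _ ENNReal.coe_ne_top]
        calc ∫⁻ t in Ioc s b, ((s * NNReal.sqrt (γ (C * s)) : ℝ≥0) : ℝ≥0∞) * invDensity γ t
              ∂(dMeasure hγ)
            ≤ ∫⁻ t in Ioc s b, ((t * NNReal.sqrt (γ (C₀ * t)) * invDensity γ t : ℝ≥0) : ℝ≥0∞)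
                ∂(dMeasure hγ) := by
              apply setLIntegral_mono' measurableSet_Ioc
              intro t ht
              norm_cast
              have h2 : C * s ≤ C₀ * t := mul_le_mul' (min_le_left _ _) ht.1.le
              gcongr
              · exact ht.1.le
              · exact hγ h2
          _ ≤ J := lintegral_mono_set fun t ht => ⟨zero_le, ht.2.trans_lt hb1⟩
    norm_cast at h1
    rw [← div_eq_mul_inv, div_le_iff₀ hR] at h1
    refine h1.trans ?_
    gcongr
    exact hγ.rightLim_le (lt_mul_of_one_lt_left hs one_lt_two)
  have hR1 := rightLim_pos hγ hpos hb0
  have hK0 : 0 < K := by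
    have h1 := hpos 1 one_pos
    have h2 : 0 < NNReal.sqrt (γ 1) := NNReal.sqrt_pos.2 h1
    rw [hK]
    positivity
  refine ⟨C / 2, 4 * K ^ 2, by positivity, ?_, by positivity, fun s hs hs1 => ?_⟩
  · calc C / 2 ≤ 1 / 2 := by gcongr; exact min_le_right _ _
      _ < 1 := hb1
  · have h1 := hmain (s / 2) (by positivity) (by rw [hb]; gcongr)
    have h2 : 2 * (s / 2) = s := by field_simp
    have h3 : C * (s / 2) = C / 2 * s := by ring
    rw [h2, h3] at h1
    calc s ^ 2 * γ (C / 2 * s) = 4 * (s / 2 * NNReal.sqrt (γ (C / 2 * s))) ^ 2 := by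
          rw [mul_pow, NNReal.sq_sqrt]
          field_simp
          ring_nf
      _ ≤ 4 * (K * γ s) ^ 2 := by gcongr
      _ = _ := by ring

/-- If `√γ` is a `γ`-augury then, up to a dilation of the variable, `γ` is dominated by `γ ^ 2`. -/
theorem exists_comp_mul_le_sq_of_isAugury_sqrt {hγ : Monotone γ} (hpos : ∀ t, 0 < t → 0 < γ t)
    (h : IsAugury hγ fun t => NNReal.sqrt (γ t)) :
    ∃ a K δ : ℝ≥0, 0 < a ∧ 0 < δ ∧ ∀ s, 0 < s → s < δ → γ (a * s) ≤ K * γ s ^ 2 := by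
  obtain ⟨a, K, ha, ha1, hK, hle⟩ := exists_sq_mul_le_of_isAugury_sqrt hpos h
  set e : ℝ≥0 := a ^ 3 / K with he
  have he0 : 0 < e := by positivity
  have hsmall : ∀ᶠ s in 𝓝[>] (0 : ℝ≥0), γ s ≤ e * s ^ 2 := by
    have h1 := isLittleO_id_iff_tendsto_div.1 h.1
    have h2 := (h1.mul h1).eventually_lt_const (u := e) (by simpa using he0)
    filter_upwards [h2, self_mem_nhdsWithin] with s hs hs0
    have hs0' : 0 < s := hs0
    rw [div_mul_div_comm, NNReal.mul_self_sqrt, div_lt_iff₀ (by positivity), ← sq] at hs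
    exact hs.le
  obtain ⟨δ, hδ, hsmall⟩ := eventually_nhdsGT_zero_iff.1 hsmall
  set s₀ : ℝ≥0 := min (δ / 2) (1 / 2) with hs₀
  have hs₀0 : 0 < s₀ := lt_min (by positivity) (by positivity)
  have hs₀δ : s₀ < δ := (min_le_left _ _).trans_lt (NNReal.half_lt_self hδ.ne')
  have hs₀1 : s₀ < 1 := (min_le_right _ _).trans_lt (by rw [← NNReal.coe_lt_coe]; norm_num)
  -- Since `√γ = o(t)`, one factor `γ(s)` in `s² γ(as) ≤ K γ(s)²` can be traded for `e s²`; `e =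
  -- a³/K` is chosen to leave the factor `a³`.
  have hstep : ∀ s, 0 < s → s ≤ s₀ → γ (a * s) ≤ a ^ 3 * γ s := by
    intro s hs hss
    have h1 := hle s hs (hss.trans_lt hs₀1)
    have h2 := hsmall s hs (hss.trans_lt hs₀δ)
    have h3 : s ^ 2 * γ (a * s) ≤ s ^ 2 * (a ^ 3 * γ s) := by
      calc s ^ 2 * γ (a * s) ≤ K * γ s ^ 2 := h1
        _ = K * γ s * γ s := by ring
        _ ≤ K * (e * s ^ 2) * γ s := by gcongr
        _ = s ^ 2 * (a ^ 3 * γ s) := by rw [he]; field_simp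
    exact le_of_mul_le_mul_left h3 (by positivity)
  have hpow : ∀ n : ℕ, γ (a ^ n * s₀) ≤ (a ^ n) ^ 3 * γ s₀ := by
    intro n
    induction n with
    | zero => simp
    | succ n ih =>
      calc γ (a ^ (n + 1) * s₀) = γ (a * (a ^ n * s₀)) := by rw [pow_succ']; ring_nf
        _ ≤ a ^ 3 * γ (a ^ n * s₀) :=
            hstep _ (by positivity) (mul_le_of_le_one_left zero_le (pow_le_one' ha1.le n))
        _ ≤ a ^ 3 * ((a ^ n) ^ 3 * γ s₀) := by gcongr
        _ = _ := by ring
  set B : ℝ≥0 := γ s₀ / (s₀ * a) ^ 3 with hB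
  -- Iterating along `aⁿ s₀` and filling the gaps by monotonicity gives cubic decay.
  have hcube : ∀ s, 0 < s → s ≤ s₀ → γ s ≤ B * s ^ 3 := by
    intro s hs hss
    obtain ⟨n, hn1, hn2⟩ := exists_nat_pow_near_of_lt_one (x := s / s₀) (by positivity)
      (div_le_one_of_le₀ hss zero_le) ha ha1
    rw [div_le_iff₀ hs₀0] at hn2
    rw [lt_div_iff₀ hs₀0] at hn1
    have h1 : a ^ n ≤ s / (s₀ * a) := by
      rw [le_div_iff₀ (by positivity)]
      calc a ^ n * (s₀ * a) = a ^ (n + 1) * s₀ := by ring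
        _ ≤ s := hn1.le
    calc γ s ≤ γ (a ^ n * s₀) := hγ hn2
      _ ≤ (a ^ n) ^ 3 * γ s₀ := hpow n
      _ ≤ (s / (s₀ * a)) ^ 3 * γ s₀ := by gcongr
      _ = B * s ^ 3 := by rw [hB, div_pow]; ring
  -- Applying the quadratic inequality at `as` and at `s` gives `a² s⁶ γ(a² s) ≤ K³ γ(s)⁴`. Two of
  -- the four factors are bounded by `B s³`, which cancels exactly `s⁶`.
  refine ⟨a ^ 2, K ^ 3 * B ^ 2 / a ^ 2, s₀, by positivity, hs₀0, fun s hs hss => ?_⟩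
  have hs1 := hss.trans hs₀1
  have has : a * s < 1 := mul_lt_one_of_nonneg_of_lt_one_left zero_le ha1 hs1.le
  have h1 := hle (a * s) (by positivity) has
  have h2 := hle s hs hs1
  have h3 := hcube s hs hss.le
  have h4 : s ^ 6 * (a ^ 2 * γ (a ^ 2 * s)) ≤ s ^ 6 * (K ^ 3 * B ^ 2 * γ s ^ 2) := by
    calc s ^ 6 * (a ^ 2 * γ (a ^ 2 * s)) = s ^ 4 * ((a * s) ^ 2 * γ (a * (a * s))) := by
          rw [sq a, mul_assoc a a s]; ring
      _ ≤ s ^ 4 * (K * γ (a * s) ^ 2) := by gcongr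
      _ = K * (s ^ 2 * γ (a * s)) ^ 2 := by ring
      _ ≤ K * (K * γ s ^ 2) ^ 2 := by gcongr
      _ = K ^ 3 * γ s ^ 2 * γ s ^ 2 := by ring
      _ ≤ K ^ 3 * γ s ^ 2 * (B * s ^ 3) ^ 2 := by gcongr
      _ = _ := by ring
  have h5 := le_of_mul_le_mul_left h4 (by positivity)
  rw [div_mul_eq_mul_div, le_div_iff₀ (by positivity)]
  calc γ (a ^ 2 * s) * a ^ 2 = a ^ 2 * γ (a ^ 2 * s) := mul_comm _ _
    _ ≤ _ := h5

end Augury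

/-! ### Assembling the equivalences. -/

section Main

variable {γ : ℝ≥0 → ℝ≥0} {lam : ℝ≥0 → ℝ≥0} {f : ℂ → ℂ} {A : ℝ≥0∞} {μ : Measure ℝ} {τ : ℝ}

theorem isRegularAt_of_amortizedJuliaBounded {hγ : Monotone γ} (hpos : ∀ t, 0 < t → 0 < γ t)
    (hf : DifferentiableOn ℂ f upperHalf) (hmaps : MapsTo f upperHalf (closure upperHalf))
    (hlam : IsAugury hγ lam) (hJ : AmortizedJuliaBounded f lam τ) : IsRegularAt γ f τ := by
  obtain ⟨A, hA, μ, hrep⟩ := exists_hasPoissonRepresentation hf hmaps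
  obtain ⟨K, hK⟩ := hrep.measure_le_of_amortizedJulia hf hmaps hlam.1 hJ
  exact isRegularAt_of_measure_le hγ hpos (hrep.isNevanlinnaMeasure hf hmaps hA) hlam hK

/-- Quantitative form of `γ`-regularity at `τ`. -/
theorem IsRegularAt.exists_bounds (h : IsRegularAt γ f τ) (hγ : Monotone γ)
    (hpos : ∀ t, 0 < t → 0 < γ t)
    (hO : (fun t : ℝ≥0 => (γ t : ℝ)) =O[𝓝[>] 0] (fun t : ℝ≥0 => (t : ℝ) ^ 2))
    (hf : DifferentiableOn ℂ f upperHalf) (hmaps : MapsTo f upperHalf (closure upperHalf)) :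
    ∃ A : ℝ≥0∞, A ≠ ∞ ∧ ∃ μ : Measure ℝ, HasPoissonRepresentation f A μ ∧
      ∫⁻ t, ((Real.nnabs (t - τ) : ℝ≥0∞) ^ 2)⁻¹ ∂μ ≠ ∞ ∧
      (∃ lam, IsAugury hγ lam ∧ ∀ d : ℝ≥0, 0 < d → 0 < lam d ∧
        μ (Icc (τ - 2 * d) (τ + 2 * d)) ≤ (d * lam d : ℝ≥0)) ∧
      ∃ c I ε : ℝ≥0, 0 < c ∧ 0 < ε ∧ ∀ d : ℝ≥0, 0 < d → d ≤ ε →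
        μ (Icc (τ - 2 * d) (τ + 2 * d)) ≤ (I * γ (c * d) : ℝ≥0) := by
  obtain ⟨A, hA, μ, hrep⟩ := exists_hasPoissonRepresentation hf hmaps
  have := hrep.isLocallyFiniteMeasure
  obtain ⟨c, hc, ε, hε, hreg⟩ :=
    h.exists_setLIntegral_lt_top (hrep.isNevanlinnaMeasure hf hmaps hA)
  refine ⟨A, hA, μ, hrep, hrep.lintegral_inv_sq_ne_top hγ hO hc hε hreg,
    exists_isAugury_of_setLIntegral_lt_top hγ hpos hO hc hε hreg, 2 * c,
    (∫⁻ t in Icc (τ - ε) (τ + ε), ((γ (c * Real.nnabs (t - τ)) : ℝ≥0∞))⁻¹ ∂μ).toNNReal, ε / 2,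
    by positivity, by positivity, fun d hd hdε => ?_⟩
  have h1 := measure_Icc_le_mul_setLIntegral (μ := μ) (τ := τ) hγ hpos hc (d := 2 * d)
    (by positivity)
  have h2 : 2 * d ≤ ε := by
    calc 2 * d ≤ 2 * (ε / 2) := by gcongr
      _ = ε := by field_simp
  have h3 : ((2 * d : ℝ≥0) : ℝ) ≤ ε := h2
  rw [ENNReal.coe_mul, ENNReal.coe_toNNReal hreg.ne]
  calc μ (Icc (τ - 2 * d) (τ + 2 * d)) ≤ _ := by simpa using h1
    _ ≤ _ := by
      rw [show c * (2 * d) = 2 * c * d by ring, mul_comm (γ (2 * c * d) : ℝ≥0∞)]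
      gcongr
      · push_cast at h3; linarith
      · push_cast at h3; linarith

/-- The mass `≤ I γ(cd)` meets the kernel bound `y⁻²`, so `γ(cd) ≤ K y²` is exactly what is needed.
The free `K` serves both the Stolz region (`K = 1`) and the curve. -/
theorem IsRegularAt.exists_juliaQuotient_le (h : IsRegularAt γ f τ) (hγ : Monotone γ)
    (hpos : ∀ t, 0 < t → 0 < γ t)
    (hO : (fun t : ℝ≥0 => (γ t : ℝ)) =O[𝓝[>] 0] (fun t : ℝ≥0 => (t : ℝ) ^ 2))
    (hf : DifferentiableOn ℂ f upperHalf) (hmaps : MapsTo f upperHalf (closure upperHalf)) :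
    ∃ c ε : ℝ≥0, 0 < c ∧ 0 < ε ∧ ∀ K : ℝ≥0, ∃ M : ℝ, ∀ z : ℂ, 0 < z.im → ∀ d : ℝ≥0, 0 < d →
      |z.re - τ| ≤ d → |z.re - τ| ≤ ε → γ (c * d) ≤ K * z.im ^ 2 →
        juliaQuotient upperHalf upperHalf f z ≤ M := by
  obtain ⟨A, hA, μ, hrep, hS, -, c, I, ε, hc, hε, hb⟩ := h.exists_bounds hγ hpos hO hf hmaps
  refine ⟨c, ε, hc, hε, fun K => ⟨((A + ENNReal.ofReal (4 / Real.pi) *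
    ∫⁻ t, ((Real.nnabs (t - τ) : ℝ≥0∞) ^ 2)⁻¹ ∂μ) + ENNReal.ofReal (I * K)).toReal,
      fun z hz d hd h1 h2 h3 => ?_⟩⟩
  have hfin : (A + ENNReal.ofReal (4 / Real.pi) *
      ∫⁻ t, ((Real.nnabs (t - τ) : ℝ≥0∞) ^ 2)⁻¹ ∂μ) + ENNReal.ofReal (I * K) ≠ ∞ :=
    ENNReal.add_ne_top.2 ⟨ENNReal.add_ne_top.2 ⟨hA, ENNReal.mul_ne_top ENNReal.ofReal_ne_top hS⟩,
      ENNReal.ofReal_ne_top⟩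
  rw [juliaQuotient_upperHalf hmaps hz, ← ENNReal.ofReal_le_iff_le_toReal hfin]
  -- The radius `d` attached to a point of a Stolz region may be large however close the point is to
  -- `τ`; the mass bound is therefore used at `min d ε`.
  have hmin : |z.re - τ| ≤ (min d ε : ℝ≥0) := by
    rw [NNReal.coe_min]; exact le_min h1 h2
  have h4 := hrep.le_add_measure hz hmin
  rw [Complex.re_add_im] at h4
  refine h4.trans ?_
  gcongr
  calc ENNReal.ofReal (z.im ^ 2)⁻¹ * μ (Icc (τ - 2 * (min d ε : ℝ≥0)) (τ + 2 * (min d ε : ℝ≥0)))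
      ≤ ENNReal.ofReal (z.im ^ 2)⁻¹ * (I * γ (c * min d ε) : ℝ≥0) := by
        gcongr
        exact hb _ (lt_min hd hε) (min_le_right _ _)
    _ ≤ ENNReal.ofReal (z.im ^ 2)⁻¹ * (I * γ (c * d) : ℝ≥0) := by
        gcongr
        exact hγ (by gcongr; exact min_le_left _ _)
    _ ≤ ENNReal.ofReal (I * K) := by
        rw [← ENNReal.ofReal_coe_nnreal, ← ENNReal.ofReal_mul (by positivity)]
        apply ENNReal.ofReal_le_ofReal
        rw [inv_mul_le_iff₀ (by positivity)]
        push_cast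
        calc (I : ℝ) * γ (c * d) ≤ I * (K * z.im ^ 2) := by gcongr
          _ = _ := by ring

theorem amortizedJulia_le (hf : DifferentiableOn ℂ f upperHalf)
    (hmaps : MapsTo f upperHalf (closure upperHalf)) {d : ℝ≥0} (hd : 0 < d) (hl : 0 < lam d)
    {M : ℝ} (hM : 0 ≤ M) (h : ∀ x ∈ Icc (τ - d) (τ + d), x ≠ τ →
      (f ((x : ℂ) + (lam d : ℝ) * Complex.I)).im / lam d ≤ M) :
    amortizedJulia upperHalf upperHalf f lam τ d ≤ M := by
  have hd' : (0 : ℝ) < d := hd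
  rw [← ENNReal.ofReal_le_ofReal_iff hM, ofReal_amortizedJulia hf hmaps τ hd hl]
  calc ENNReal.ofReal (2 * d)⁻¹ * ∫⁻ x in Icc (τ - d) (τ + d),
        ENNReal.ofReal ((f ((x : ℂ) + (lam d : ℝ) * Complex.I)).im / lam d)
      ≤ ENNReal.ofReal (2 * (d : ℝ))⁻¹ * ∫⁻ x in Icc (τ - d) (τ + d), ENNReal.ofReal M := by
        gcongr 1
        apply lintegral_mono_ae
        rw [ae_restrict_iff' measurableSet_Icc]
        have h1 : ∀ᵐ x : ℝ, x ≠ τ := by rw [ae_iff]; simp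
        filter_upwards [h1] with x hx hxI
        exact ENNReal.ofReal_le_ofReal (h x hxI hx)
    _ = ENNReal.ofReal M := by
        rw [setLIntegral_const, Real.volume_Icc, mul_left_comm, ← ENNReal.ofReal_mul (by positivity)]
        have : (2 * (d : ℝ))⁻¹ * (τ + d - (τ - d)) = 1 := by
          rw [show τ + d - (τ - d) = 2 * (d : ℝ) by ring, inv_mul_cancel₀ (by positivity)]
        rw [this, ENNReal.ofReal_one, mul_one]

/-- The segment defining the average at `d` lies in the Stolz region, with `d` itself as witness,
and shrinks to `τ`. -/
theorem amortizedJuliaBounded_of_stolzRegion (hf : DifferentiableOn ℂ f upperHalf)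
    (hmaps : MapsTo f upperHalf (closure upperHalf)) (hpos : ∀ t, 0 < t → 0 < lam t)
    (ho : (fun t : ℝ≥0 => (lam t : ℝ)) =o[𝓝[>] 0] (fun t : ℝ≥0 => (t : ℝ))) {M : ℝ}
    (h : ∀ᶠ z in 𝓝[stolzRegion upperHalf lam (τ : ℂ)] (τ : ℂ),
      juliaQuotient upperHalf upperHalf f z ≤ M) :
    AmortizedJuliaBounded f lam τ := by
  obtain ⟨η, hη, hsub⟩ := Metric.mem_nhdsWithin_iff.1 h
  refine ⟨max M 0, ?_⟩
  have hsmall : ∀ᶠ d in 𝓝[>] (0 : ℝ≥0), d < η.toNNReal / 2 := by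
    rw [eventually_nhdsGT_zero_iff]
    exact ⟨η.toNNReal / 2, by simpa using hη, fun d _ h => h⟩
  filter_upwards [ho.bound one_pos, hsmall, self_mem_nhdsWithin] with d h1 h2 hd
  have hl := hpos d hd
  refine ⟨hl, amortizedJulia_le hf hmaps hd hl (le_max_right _ _) fun x hx _ => ?_⟩
  have hl' : (0 : ℝ) < lam d := hl
  have hld : (lam d : ℝ) ≤ d := by simpa using h1
  have hdη : 2 * (d : ℝ) < η := by
    have : (d : ℝ) < η.toNNReal / 2 := by exact_mod_cast h2
    rw [Real.coe_toNNReal _ hη.le] at this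
    linarith
  set z : ℂ := (x : ℂ) + (lam d : ℝ) * Complex.I with hz
  have hre : z.re = x := by simp [hz]
  have him : z.im = lam d := by simp [hz]
  have hxd : |x - τ| ≤ d := abs_le.2 ⟨by linarith [hx.1], by linarith [hx.2]⟩
  have hmem : z ∈ Metric.ball (τ : ℂ) η ∩ stolzRegion upperHalf lam (τ : ℂ) := by
    refine ⟨?_, ?_, d, hd, ?_, ?_⟩
    · rw [Metric.mem_ball, Complex.dist_eq]
      calc ‖z - τ‖ ≤ |(z - τ).re| + |(z - τ).im| := Complex.norm_le_abs_re_add_abs_im _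
        _ = |x - τ| + lam d := by simp [hre, him]
        _ < η := by linarith
    · change 0 < z.im
      rw [him]; exact hl'
    · rw [infDist_frontier_upperHalf, him, abs_of_pos hl']
    · rw [tangentialDist_upperHalf, hre]; exact hxd
  have := hsub hmem
  rw [mem_ofPred_eq, juliaQuotient_upperHalf hmaps (by rw [him]; exact hl'), him] at this
  exact this.trans (le_max_left _ _)

/-- Monotonicity of `λ` places the curve below the segment of height `λ(d)`, and the quotient
decreases upwards. The point above `τ`, which the curve misses, is a null set. -/
theorem amortizedJuliaBounded_of_limsup_lt_top (hf : DifferentiableOn ℂ f upperHalf)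
    (hmaps : MapsTo f upperHalf (closure upperHalf)) (hmono : Monotone lam)
    (hpos : ∀ t, 0 < t → 0 < lam t)
    (h : limsup (fun t : ℝ => ((juliaQuotient upperHalf upperHalf f
      (((τ + t : ℝ) : ℂ) + ((lam (Real.nnabs t) : ℝ≥0) : ℝ) * Complex.I) : ℝ) : EReal))
        (𝓝[≠] 0) < ⊤) :
    AmortizedJuliaBounded f lam τ := by
  obtain ⟨A, hA, μ, hrep⟩ := exists_hasPoissonRepresentation hf hmaps
  obtain ⟨M, hM, -⟩ := EReal.lt_iff_exists_real_btwn.1 h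
  have hev := eventually_lt_of_limsup_lt hM
  rw [eventually_iff, Metric.mem_nhdsWithin_iff] at hev
  obtain ⟨η, hη, hsub⟩ := hev
  refine ⟨max M 0, ?_⟩
  rw [eventually_nhdsGT_zero_iff]
  refine ⟨η.toNNReal, by simpa using hη, fun d hd hdη => ?_⟩
  have hl := hpos d hd
  refine ⟨hl, amortizedJulia_le hf hmaps hd hl (le_max_right _ _) fun x hx hxτ => ?_⟩
  have hxd : |x - τ| ≤ d := abs_le.2 ⟨by linarith [hx.1], by linarith [hx.2]⟩
  have hdη' : (d : ℝ) < η := by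
    have : (d : ℝ) < η.toNNReal := hdη
    rwa [Real.coe_toNNReal _ hη.le] at this
  have hx0 : 0 < Real.nnabs (x - τ) := Real.nnabs_pos.2 (sub_ne_zero.2 hxτ)
  have hy : (0 : ℝ) < lam (Real.nnabs (x - τ)) := hpos _ hx0
  have hyd : (lam (Real.nnabs (x - τ)) : ℝ) ≤ lam d := by
    apply NNReal.coe_le_coe.2 (hmono _)
    rw [← NNReal.coe_le_coe, Real.coe_nnabs]
    exact hxd
  have hmem : x - τ ∈ Metric.ball (0 : ℝ) η ∩ {0}ᶜ := by
    refine ⟨?_, sub_ne_zero.2 hxτ⟩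
    rw [mem_ball_zero_iff, Real.norm_eq_abs]
    linarith
  have h1 := hsub hmem
  rw [mem_ofPred_eq, EReal.coe_lt_coe_iff, add_sub_cancel,
    juliaQuotient_upperHalf hmaps (by simpa using hy)] at h1
  have h2 := hrep.anti (x := x) hy hyd
  have h3 : (f ((x : ℂ) + (lam (Real.nnabs (x - τ)) : ℝ) * Complex.I)).im /
      lam (Real.nnabs (x - τ)) ≤ max M 0 := by
    refine le_trans ?_ (h1.le.trans (le_max_left _ _))
    apply le_of_eq
    simp
  rw [← ENNReal.ofReal_le_ofReal_iff (le_max_right _ _)]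
  exact h2.trans (ENNReal.ofReal_le_ofReal h3)

end Main

end JuliaAugury

theorem theorem1p1
    (γ : ℝ≥0 → ℝ≥0) (hmono : Monotone γ) (hpos : ∀ t : ℝ≥0, 0 < t → 0 < γ t)
    (hO : (fun t : ℝ≥0 => (γ t : ℝ)) =O[𝓝[>] 0] (fun t : ℝ≥0 => (t : ℝ) ^ 2))
    (τ : ℝ) (f : ℂ → ℂ)
    (hf : DifferentiableOn ℂ f JuliaAugury.upperHalf)
    (hmaps : MapsTo f JuliaAugury.upperHalf (closure JuliaAugury.upperHalf)) :
    (JuliaAugury.IsRegularAt γ f τ ↔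
      ∃ lam : ℝ≥0 → ℝ≥0,
        JuliaAugury.IsAugury hmono lam ∧ JuliaAugury.AmortizedJuliaBounded f lam τ) ∧
    (JuliaAugury.IsAugury hmono (fun t => NNReal.sqrt (γ t)) →
      List.TFAE
        [JuliaAugury.IsRegularAt γ f τ,
         ∃ C D : ℝ≥0, 0 < C ∧ 0 < D ∧ ∃ M : ℝ,
           ∀ᶠ z in 𝓝[JuliaAugury.stolzRegion JuliaAugury.upperHalf
                (fun t => NNReal.sqrt (D * γ (C * t))) (τ : ℂ)] (τ : ℂ),
              JuliaAugury.juliaQuotient JuliaAugury.upperHalf JuliaAugury.upperHalf f z ≤ M,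
         ∃ C D : ℝ≥0, 0 < C ∧ 0 < D ∧
           limsup (fun t : ℝ =>
              ((JuliaAugury.juliaQuotient JuliaAugury.upperHalf JuliaAugury.upperHalf f
                (((τ + t : ℝ) : ℂ) + ((D * γ (C * Real.nnabs t) : ℝ≥0) : ℝ) * Complex.I) : ℝ)
                  : EReal)) (𝓝[≠] 0) < ⊤]) ∧
    (JuliaAugury.IsAugury hmono (fun t => γ t / t) →
      (JuliaAugury.IsRegularAt γ f τ ↔
        ∃ C : ℝ≥0, 0 < C ∧
          JuliaAugury.AmortizedJuliaBounded f (fun t => γ (C * t) / (C * t)) τ)) := by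
  open JuliaAugury in
  have hγm := hmono.measurable
  refine ⟨⟨fun h => ?_, fun ⟨lam, hlam, hJ⟩ =>
    isRegularAt_of_amortizedJuliaBounded hpos hf hmaps hlam hJ⟩, fun haug => ?_,
      fun haug => ⟨fun h => ?_, fun ⟨C, hC, hJ⟩ => ?_⟩⟩
  · obtain ⟨A, hA, μ, hrep, hS, ⟨lam, hlam, hle⟩, -⟩ := h.exists_bounds hmono hpos hO hf hmaps
    refine ⟨lam, hlam, hrep.amortizedJuliaBounded hA hf hmaps hS (K := 1) ?_⟩
    filter_upwards [self_mem_nhdsWithin] with d hd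
    rw [one_mul]
    exact hle d hd
  · have hsm : Measurable fun t => NNReal.sqrt (γ t) := by fun_prop
    tfae_have 1 → 2 := by
      intro h
      obtain ⟨c, ε, hc, hε, hb⟩ := h.exists_juliaQuotient_le hmono hpos hO hf hmaps
      obtain ⟨M, hM⟩ := hb 1
      refine ⟨c, 1, hc, one_pos, M, ?_⟩
      have hε' : (0 : ℝ) < ε := hε
      filter_upwards [self_mem_nhdsWithin,
        mem_nhdsWithin_of_mem_nhds (Metric.closedBall_mem_nhds (τ : ℂ) hε')] with z hz hzε
      obtain ⟨hz0, d, hd, h1, h2⟩ := hz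
      rw [infDist_frontier_upperHalf, abs_of_pos (show 0 < z.im from hz0)] at h1
      rw [tangentialDist_upperHalf] at h2
      refine hM z hz0 d hd h2 ?_ ?_
      · rw [Metric.mem_closedBall, Complex.dist_eq] at hzε
        have := Complex.abs_re_le_norm (z - τ)
        rw [Complex.sub_re, Complex.ofReal_re] at this
        exact this.trans hzε
      · beta_reduce at h1
        rw [one_mul] at h1
        calc ((γ (c * d) : ℝ≥0) : ℝ) = (NNReal.sqrt (γ (c * d)) : ℝ) ^ 2 := by
              rw [← NNReal.coe_pow, NNReal.sq_sqrt]
          _ ≤ z.im ^ 2 := by gcongr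
          _ = _ := by simp
    tfae_have 1 → 3 := by
      intro h
      obtain ⟨c, ε, hc, hε, hb⟩ := h.exists_juliaQuotient_le hmono hpos hO hf hmaps
      obtain ⟨a, K, δ, ha, hδ, hle⟩ := exists_comp_mul_le_sq_of_isAugury_sqrt hpos haug
      obtain ⟨M, hM⟩ := hb K
      -- With the dilation `c/a`, the inequality `γ(as) ≤ K γ(s)²` at `s = (c/a)|t|` becomes
      -- `γ(c|t|) ≤ K y²` on the curve.
      refine ⟨c / a, 1, by positivity, one_pos, ?_⟩
      refine lt_of_le_of_lt (limsup_le_of_le (h := ?_)) (EReal.coe_lt_top M)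
      set ρ : ℝ≥0 := min ε (δ / (c / a)) with hρ
      have hρ0 : (0 : ℝ) < ρ := NNReal.coe_pos.2 (lt_min hε (by positivity))
      filter_upwards [self_mem_nhdsWithin,
        mem_nhdsWithin_of_mem_nhds (Metric.ball_mem_nhds (0 : ℝ) hρ0)] with t ht0 htρ
      have ht : 0 < Real.nnabs t := Real.nnabs_pos.2 ht0
      have htρ' : Real.nnabs t < ρ := by
        rw [mem_ball_zero_iff, Real.norm_eq_abs, ← Real.coe_nnabs] at htρ
        exact htρ
      have hγt : (0 : ℝ) < γ (c / a * Real.nnabs t) := hpos _ (by positivity)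
      rw [EReal.coe_le_coe_iff, one_mul]
      apply hM _ (by simpa using hγt) (Real.nnabs t) ht (by simp)
      · have : (Real.nnabs t : ℝ) ≤ ε := htρ'.le.trans (min_le_left _ _)
        rw [Real.coe_nnabs] at this
        simpa using this
      · have h1 : c / a * Real.nnabs t < δ := by
          have := htρ'.trans_le (min_le_right _ _)
          rwa [lt_div_iff₀ (by positivity), mul_comm] at this
        have h2 := hle (c / a * Real.nnabs t) (by positivity) h1
        rw [show a * (c / a * Real.nnabs t) = c * Real.nnabs t by field_simp] at h2
        have h3 : ((γ (c * Real.nnabs t) : ℝ≥0) : ℝ) ≤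
          (K * γ (c / a * Real.nnabs t) ^ 2 : ℝ≥0) := h2
        simpa using h3
    tfae_have 2 → 1 := by
      rintro ⟨C, D, hC, hD, M, hM⟩
      have hlam : IsAugury hmono fun t => NNReal.sqrt (D * γ (C * t)) := by
        simp_rw [NNReal.sqrt_mul]
        exact haug.const_mul_comp hsm hC _
      refine isRegularAt_of_amortizedJuliaBounded hpos hf hmaps hlam
        (amortizedJuliaBounded_of_stolzRegion hf hmaps (fun t ht => ?_) hlam.1 hM)
      have := hpos (C * t) (by positivity)
      exact NNReal.sqrt_pos.2 (by positivity)
    tfae_have 3 → 1 := by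
      rintro ⟨C, D, hC, hD, hlim⟩
      have hlam : IsAugury hmono fun t => D * γ (C * t) :=
        (isAugury_self_of_sqrt haug).const_mul_comp hγm hC D
      refine isRegularAt_of_amortizedJuliaBounded hpos hf hmaps hlam
        (amortizedJuliaBounded_of_limsup_lt_top hf hmaps (fun s t hst => ?_) (fun t ht => ?_) hlim)
      · have := hmono (show C * s ≤ C * t by gcongr)
        gcongr
      · have := hpos (C * t) (by positivity)
        positivity
    tfae_finish
  · obtain ⟨A, hA, μ, hrep, hS, -, c, I, ε, hc, hε, hle⟩ :=
      h.exists_bounds hmono hpos hO hf hmaps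
    -- `I γ(cd) = (I c) · d · γ(cd)/(cd)`, so Markov's bound is already of the required form.
    refine ⟨c, hc, hrep.amortizedJuliaBounded hA hf hmaps hS (K := I * c) ?_⟩
    rw [eventually_nhdsGT_zero_iff]
    refine ⟨ε, hε, fun d hd hdε => ⟨?_, ?_⟩⟩
    · have := hpos (c * d) (by positivity)
      positivity
    · refine (hle d hd hdε.le).trans_eq ?_
      norm_cast
      field_simp
  · have hlam : IsAugury hmono fun t => γ (C * t) / (C * t) := by
      simpa using haug.const_mul_comp (by fun_prop) hC 1
    exact isRegularAt_of_amortizedJuliaBounded hpos hf hmaps hlam hJ
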